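/- Let $d\ge 1$ and let $\mathcal K$ be the set of non-empty compact subsets of $\mathbb R^d$, with the Hausdorff metric and its Borel $\sigma$-algebra. A configuration is a set $\varphi\subset\mathcal K$ such that every compact subset of $\mathbb R^d$ meets only finitely many $K\in\varphi$; it satisfies the hard-core constraint if distinct elements of $\varphi$ have disjoint interiors. A particle process is a random configuration. Let $\Phi$ be a stationary particle process on a probability space $(\Omega_0,\mathcal F_0,\mathbb P_0)$ with intensity $\gamma_0=\mathbb E\,\#\{K\in\Phi:\ c(K)\in[0,1]^d\}\in(0,\infty)$, where $c(K)$ is the center of gravity of $K$, and with typical grain distribution $\mathbb Q(A)=\gamma_0^{-1}\,\mathbb E\,\#\{K\in\Phi:\ c(K)\in[0,1]^d,\ K-c(K)\in A\}$. (For $\lambda_d(K)=0$, $c(K)$ is the limit as $n\to\infty$ of the centers of gravity of the closed $1/n$-neighbourhoods of $K$ if that limit exists, and the center of gravity of the closed $1$-neighbourhood of $K$ otherwise.) Let $h:\mathcal K\to[0,\infty)$ be measurable and translation invariant. For a stationary particle process $\Psi$ with intensity $\gamma$ and typical grain distribution $\mathbb Q_\Psi$ put $\gamma_h(\Psi)=\gamma\int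 h(K)\,\mathbb Q_\Psi(dK)$. A stationary hard-core thinning of $\Phi$ is a particle process $\Psi$ on some probability space $(\Omega,\mathcal F,\mathbb P)$, together with a measurable map $S:\Omega\to\Omega_0$, such that $\mathbb P_0$ is the image of $\mathbb P$ under $S$, $\Psi$ is a realizationwise subset of $\Phi\circ S$, the pair $(\Phi\circ S,\Psi)$ is jointly stationary, and $\Psi$ almost surely satisfies the hard-core constraint. It is $h$-intensity maximal if $\gamma_h(\Psi)$ equals the supremum of $\gamma_h$ over all stationary hard-core thinnings of $\Phi$. It is almost surely locally $h$-maximal if with probability one, with $\psi=\Psi$ and $\varphi=\Phi\circ S$, for every $\psi'\subset\varphi$ that satisfies the hard-core constraint and for which $\psi\,\Delta\,\psi'$ is finite, $$\sum_{K\in\psi'\setminus\psi}h(K)\ \le\ \sum_{K\in\psi\setminus\psi'}h(K).$$ Write $\mathcal T_{h,\mathrm{i\text{-}max}}$ and $\mathcal T_{h,\ell\text{-}\mathrm{max}}$ for the corresponding classes of stationary hard-core thinnings of $\Phi$. If $\gamma_h(\Phi)<\infty$, then $\mathcal T_{h,\mathrm{i\text{-}max}}\subset\mathcal T_{h,\ell\text{-}\mathrm{max}}$.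 If in addition $$\int\lambda_d\big(K\oplus[-1,1]^d\big)\,h(K)\,\mathbb Q(dK)<\infty,$$ then $\mathcal T_{h,\mathrm{i\text{-}max}}=\mathcal T_{h,\ell\text{-}\mathrm{max}}$. -/

import Mathlib

open MeasureTheory Set Filter Topology
open scoped NNReal ENNReal Pointwise

universe u

namespace HardCore

/-- The family of non-empty compact subsets of `ℝ^d`. Mathlib equips it with the Hausdorff
metric. -/
abbrev Grain (d : ℕ) : Type := TopologicalSpace.NonemptyCompacts (EuclideanSpace ℝ (Fin d))

instance Grain.instMeasurableSpace (d : ℕ) : MeasurableSpace (Grain d) := borel (Grain d)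

instance Grain.instBorelSpace (d : ℕ) : BorelSpace (Grain d) := ⟨rfl⟩

/-- The translate `x + K`. -/
def Grain.translate {d : ℕ} (x : EuclideanSpace ℝ (Fin d)) (K : Grain d) : Grain d :=
  K.map (fun y => x + y) (continuous_const.add continuous_id)

/-- The axis-parallel cube `[a, b]^d`. -/
def cube (d : ℕ) (a b : ℝ) : Set (EuclideanSpace ℝ (Fin d)) :=
  {x | ∀ i, x i ∈ Icc a b}

/-- The center of gravity of the closed `r`-neighbourhood of `K`. -/
noncomputable def Grain.parallelCentroid {d : ℕ} (K : Grain d) (r : ℝ) :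
    EuclideanSpace ℝ (Fin d) :=
  ⨍ y in Metric.cthickening r (K : Set (EuclideanSpace ℝ (Fin d))), y

open Classical in
/-- The center of gravity `c(K)`. For a set of positive volume this is the mean of the uniform
distribution on `K`. For a null set it is the limit of the centers of gravity of the closed
`r`-neighbourhoods as `r = 1/(n+1)` tends to `0` (for a lower-dimensional convex set this is the
center of gravity within its affine hull, for a finite set the mean of its points). Null sets for
which this limit does not exist have no center of gravity; they are given the center of gravity
of the closed unit neighbourhood, so that `c` is translation covariant on all grains. -/
noncomputable def Grain.center {d : ℕ} (K : Grain d) : EuclideanSpace ℝ (Fin d) :=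
  if volume (K : Set (EuclideanSpace ℝ (Fin d))) ≠ 0 then
    ⨍ y in (K : Set (EuclideanSpace ℝ (Fin d))), y
  else if h : ∃ z, Tendsto (fun n : ℕ => K.parallelCentroid (1 / ((n : ℝ) + 1))) atTop (𝓝 z) then
    h.choose
  else K.parallelCentroid 1

/-- Locally finite particle configurations: sets of grains such that every compact subset of
`ℝ^d` is hit by only finitely many of them. -/
structure Config (d : ℕ) where
  /-- The set of particles. -/
  grains : Set (Grain d)
  locallyFinite : ∀ C : Set (EuclideanSpace ℝ (Fin d)), IsCompact C →
    {K ∈ grains | ((K : Set (EuclideanSpace ℝ (Fin d))) ∩ C).Nonempty}.Finite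

/-- The counting measure of a configuration. -/
noncomputable def Config.toMeasure {d : ℕ} (φ : Config d) : Measure (Grain d) :=
  Measure.sum fun K : φ.grains => Measure.dirac (K : Grain d)

/-- The usual sigma-algebra on configurations, generated by the particle counts `φ ↦ φ(A)` for
Borel sets `A` of grains. -/
noncomputable instance Config.instMeasurableSpace (d : ℕ) : MeasurableSpace (Config d) :=
  MeasurableSpace.comap Config.toMeasure inferInstance

/-- The configuration `{x + K : K ∈ φ}`. -/
def Config.translate {d : ℕ} (x : EuclideanSpace ℝ (Fin d)) (φ : Config d) : Config d where
  grains := Grain.translate x '' φ.grains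
  locallyFinite := by
    intro C hC
    have hC' : IsCompact ((fun y => -x + y) '' C) :=
      hC.image (continuous_const.add continuous_id)
    refine ((φ.locallyFinite _ hC').image (Grain.translate x)).subset ?_
    rintro _ ⟨⟨K, hK, rfl⟩, z, hz, hzC⟩
    refine ⟨K, ⟨hK, ?_⟩, rfl⟩
    obtain ⟨y, hy, rfl⟩ := hz
    exact ⟨y, hy, x + y, hzC, by simp⟩

/-- The hard-core constraint: the interiors of distinct particles do not meet. -/
def IsHardCore {d : ℕ} (φ : Set (Grain d)) : Prop :=
  φ.Pairwise fun K L => Disjoint (interior (K : Set (EuclideanSpace ℝ (Fin d))))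
    (interior (L : Set (EuclideanSpace ℝ (Fin d))))

/-- `ψ` is a locally `h`-maximal thinning of `φ`: no swap of finitely many particles that
preserves the hard-core constraint increases the total `h`-value. -/
def IsLocallyMaximal {d : ℕ} (h : Grain d → ℝ≥0) (φ ψ : Set (Grain d)) : Prop :=
  ψ ⊆ φ ∧ IsHardCore ψ ∧
    ∀ ψ' : Set (Grain d), ψ' ⊆ φ → IsHardCore ψ' → (symmDiff ψ ψ').Finite →
      ∑ᶠ K ∈ ψ' \ ψ, h K ≤ ∑ᶠ K ∈ ψ \ ψ', h K

section Intensity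

variable {d : ℕ} {Ω : Type u} [MeasurableSpace Ω]

/-- Stationarity of a random configuration `X`. -/
def IsStationary (P : Measure Ω) (X : Ω → Config d) : Prop :=
  ∀ x : EuclideanSpace ℝ (Fin d), P.map (fun ω => (X ω).translate x) = P.map X

/-- Joint stationarity of two random configurations on the same space. -/
def IsJointlyStationary (P : Measure Ω) (X Y : Ω → Config d) : Prop :=
  ∀ x : EuclideanSpace ℝ (Fin d),
    P.map (fun ω => ((X ω).translate x, (Y ω).translate x)) = P.map (fun ω => (X ω, Y ω))

/-- The intensity measure `A ↦ 𝔼 X(A)` on grains. -/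
noncomputable def intensityMeasure (P : Measure Ω) (X : Ω → Config d) : Measure (Grain d) :=
  P.bind fun ω => (X ω).toMeasure

/-- The intensity: the expected number of particles with center in the unit cube. -/
noncomputable def intensity (P : Measure Ω) (X : Ω → Config d) : ℝ≥0∞ :=
  ∫⁻ ω, (X ω).toMeasure {K | K.center ∈ cube d 0 1} ∂P

/-- The typical grain distribution: the law of the centered particles `K - c(K)` with
`c(K)` in the unit cube, normalized by the intensity. -/
noncomputable def typicalGrain (P : Measure Ω) (X : Ω → Config d) : Measure (Grain d) :=
  (intensity P X)⁻¹ •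
    ((intensityMeasure P X).restrict {K | K.center ∈ cube d 0 1}).map
      (fun K => K.translate (-K.center))

/-- The `h`-intensity. -/
noncomputable def hIntensity (h : Grain d → ℝ≥0) (P : Measure Ω) (X : Ω → Config d) : ℝ≥0∞ :=
  intensity P X * ∫⁻ K, (h K : ℝ≥0∞) ∂(typicalGrain P X)

end Intensity

/-- A stationary hard-core thinning of the particle process `Φ` defined on `(Ω₀, P₀)`: a particle
process `Ψ` on some probability space `(Ω, P)` with a measurable map `S : Ω → Ω₀` such that `P₀`
is the image of `P` under `S`, the process `Ψ` is a realizationwise subset of `Φ ∘ S`, the pair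
`(Φ ∘ S, Ψ)` is jointly stationary and `Ψ` almost surely satisfies the hard-core constraint. -/
structure HardCoreThinning {d : ℕ} {Ω₀ : Type u} [MeasurableSpace Ω₀] (P₀ : Measure Ω₀)
    (Φ : Ω₀ → Config d) where
  /-- The underlying space. -/
  Ω : Type u
  [measurableSpace : MeasurableSpace Ω]
  /-- The probability measure. -/
  P : Measure Ω
  [isProbabilityMeasure : IsProbabilityMeasure P]
  /-- The map to the space on which `Φ` is defined. -/
  S : Ω → Ω₀
  /-- The thinned particle process. -/
  Ψ : Ω → Config d
  measurePreserving_S : MeasurePreserving S P P₀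
  measurable_Ψ : Measurable Ψ
  subset : ∀ ω, (Ψ ω).grains ⊆ (Φ (S ω)).grains
  jointlyStationary : IsJointlyStationary P (fun ω => Φ (S ω)) Ψ
  hardCore : ∀ᵐ ω ∂P, IsHardCore (Ψ ω).grains

attribute [instance] HardCoreThinning.measurableSpace HardCoreThinning.isProbabilityMeasure

section Maximality

variable {d : ℕ} {Ω₀ : Type u} [MeasurableSpace Ω₀]

/-- The maximal `h`-intensity of stationary hard-core thinnings of `Φ`. -/
noncomputable def maxHIntensity (h : Grain d → ℝ≥0) (P₀ : Measure Ω₀) (Φ : Ω₀ → Config d) :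
    ℝ≥0∞ :=
  ⨆ T : HardCoreThinning P₀ Φ, hIntensity h T.P T.Ψ

/-- The class of `h`-intensity maximal stationary hard-core thinnings of `Φ`. -/
def intensityMaximal (h : Grain d → ℝ≥0) (P₀ : Measure Ω₀) (Φ : Ω₀ → Config d) :
    Set (HardCoreThinning P₀ Φ) :=
  {T | hIntensity h T.P T.Ψ = maxHIntensity h P₀ Φ}

/-- The class of stationary hard-core thinnings of `Φ` that are almost surely locally
`h`-maximal. -/
def locallyMaximal (h : Grain d → ℝ≥0) (P₀ : Measure Ω₀) (Φ : Ω₀ → Config d) :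
    Set (HardCoreThinning P₀ Φ) :=
  {T | ∀ᵐ ω ∂T.P, IsLocallyMaximal h (Φ (T.S ω)).grains (T.Ψ ω).grains}

end Maximality

end HardCore

/-!
Both inclusions compare a thinning with competitors that differ from it inside a bounded region.

*Intensity maximal thinnings are locally maximal.* A finite improvement of `ψ` inside `φ` takes
place in a bounded cell `W` of a lattice tiling, and there it is described by a set `V` from a
countable family of Borel sets of grains: replace the particles of `ψ` in the cell by the particles
of `φ` in the cell that belong to `V` (`isLocallyMaximal_of_forall_not_isImproving`). So if a
thinning fails to be locally maximal with positive probability, one pair `(W, V)` gives an improving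
swap with positive probability. Carry out that swap simultaneously in all cells where it is
improving (`cellSwap`). Grains in the interiors of different cells do not overlap, so the result is
hard-core, and it is covariant under the lattice. Shifting the lattice by an independent uniform
vector makes it stationary (`exists_thinning_of_covariant`), and its `h`-intensity is strictly
larger (`ae_not_isImproving`).

*Locally maximal thinnings are intensity maximal.* Let `W = [0, n]^d`. The largest value
`bestValue` of a hard-core family of particles of `φ` inside `W` bounds the value inside `W` of an
arbitrary thinning, and is itself bounded by the value of the particles of a locally maximal
thinning that meet `W`. As `bestValue` depends on `Φ` only, expectations can be compared without
coupling the two thinnings (`setLIntegral_inside_le_hitting`). What remains are the contributions of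
the grains at the boundary of `W`. By Campbell's formula (`campbell`), the size condition and
dominated convergence they are `o(n^d)` (`tendsto_boundary_value`).

Measurability rests on two facts. Overlap of interiors is witnessed by a ball from a countable
family, so the hard-core property is an event (`measurableSet_isHardCore`). Configurations define an
s-finite kernel of counting measures, so that integrals against a configuration are jointly
measurable with other parameters (`Config.measurable_lintegral`).
-/

namespace HardCore

/-- The Euclidean space `ℝ^d`. -/
abbrev Space (d : ℕ) : Type := EuclideanSpace ℝ (Fin d)

/-! ### Grains: translations, centers, measurability -/

namespace Grain

variable {d : ℕ}

theorem coe_translate (x : Space d) (K : Grain d) :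
    (K.translate x : Set (Space d)) = (fun y => x + y) '' (K : Set (Space d)) :=
  rfl

theorem mem_translate {x y : Space d} {K : Grain d} : y ∈ K.translate x ↔ y - x ∈ K := by
  change y ∈ (K.translate x : Set (Space d)) ↔ y - x ∈ (K : Set (Space d))
  rw [coe_translate]
  constructor
  · rintro ⟨z, hz, rfl⟩
    simpa using hz
  · intro h
    exact ⟨y - x, h, by simp⟩

theorem translate_translate (x y : Space d) (K : Grain d) :
    (K.translate y).translate x = K.translate (x + y) := by
  ext z
  change z ∈ (K.translate y).translate x ↔ z ∈ K.translate (x + y)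
  rw [mem_translate, mem_translate, mem_translate, sub_sub]

@[simp]
theorem translate_zero (K : Grain d) : K.translate 0 = K := by
  ext z
  change z ∈ K.translate 0 ↔ z ∈ K
  rw [mem_translate, sub_zero]

@[simp]
theorem translate_neg_translate (x : Space d) (K : Grain d) :
    (K.translate x).translate (-x) = K := by
  rw [translate_translate, neg_add_cancel, translate_zero]

@[simp]
theorem translate_translate_neg (x : Space d) (K : Grain d) :
    (K.translate (-x)).translate x = K := by
  rw [translate_translate, add_neg_cancel, translate_zero]

theorem translate_injective (x : Space d) : Function.Injective (Grain.translate x) :=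
  Function.LeftInverse.injective (g := Grain.translate (-x)) (translate_neg_translate x)

theorem continuous_translate :
    Continuous fun p : Space d × Grain d => p.2.translate p.1 := by
  unfold Grain.translate
  exact continuous_snd.nonemptyCompacts_map'
    (g := fun (p : Space d × Grain d) (y : Space d) => p.1 + y)
    (by unfold Function.uncurry; fun_prop)

theorem measurable_translate :
    Measurable fun p : Space d × Grain d => p.2.translate p.1 :=
  continuous_translate.measurable

theorem measurable_translate_left (x : Space d) : Measurable (Grain.translate x) :=
  measurable_translate.comp (measurable_const.prodMk measurable_id)

theorem interior_translate (x : Space d) (K : Grain d) :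
    interior (K.translate x : Set (Space d)) =
      (fun y => x + y) '' interior (K : Set (Space d)) := by
  rw [coe_translate]
  exact ((Homeomorph.addLeft x).image_interior _).symm

theorem isClosed_setOf_superset (B : Set (Space d)) :
    IsClosed {K : Grain d | B ⊆ (K : Set (Space d))} := by
  have : {K : Grain d | B ⊆ (K : Set (Space d))} =
      ⋂ x ∈ B, {K : Grain d | ((K : Set (Space d)) ∩ {x}).Nonempty} := by
    ext K
    simp [Set.subset_def]
  rw [this]
  exact isClosed_biInter fun x _ =>
    TopologicalSpace.NonemptyCompacts.isClosed_inter_nonempty_of_isClosed isClosed_singleton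

theorem measurableSet_subset {U : Set (Space d)} (hU : IsOpen U) :
    MeasurableSet {K : Grain d | (K : Set (Space d)) ⊆ U} :=
  (TopologicalSpace.NonemptyCompacts.isOpen_subsets_of_isOpen hU).measurableSet

theorem measurableSet_subset_of_isClosed {F : Set (Space d)} (hF : IsClosed F) :
    MeasurableSet {K : Grain d | (K : Set (Space d)) ⊆ F} :=
  (TopologicalSpace.NonemptyCompacts.isClosed_subsets_of_isClosed hF).measurableSet

theorem measurableSet_hit {F : Set (Space d)} (hF : IsClosed F) :
    MeasurableSet {K : Grain d | ((K : Set (Space d)) ∩ F).Nonempty} :=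
  (TopologicalSpace.NonemptyCompacts.isClosed_inter_nonempty_of_isClosed hF).measurableSet

theorem continuous_infDist_nonemptyCompacts {α : Type*} [MetricSpace α] :
    Continuous fun p : TopologicalSpace.NonemptyCompacts α × α =>
      Metric.infDist p.2 (p.1 : Set α) := by
  have h : Continuous fun p : α × TopologicalSpace.NonemptyCompacts α =>
      Metric.infDist p.1 (p.2 : Set α) := Metric.lipschitz_infDist.continuous
  exact Continuous.comp (f := Prod.swap)
    (g := fun p : α × TopologicalSpace.NonemptyCompacts α => Metric.infDist p.1 (p.2 : Set α))
    h continuous_swap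

theorem isClosed_setOf_mem_cthickening (r : ℝ) :
    IsClosed {p : Grain d × Space d | p.2 ∈ Metric.cthickening r (p.1 : Set (Space d))} := by
  have hc : Continuous fun p : Grain d × Space d => Metric.infDist p.2 (p.1 : Set (Space d)) :=
    continuous_infDist_nonemptyCompacts
  have : {p : Grain d × Space d | p.2 ∈ Metric.cthickening r (p.1 : Set (Space d))} =
      {p | Metric.infDist p.2 (p.1 : Set (Space d)) ≤ max r 0} := by
    ext p
    rw [mem_ofPred_eq, mem_ofPred_eq, Metric.mem_cthickening_iff,
      ← max_eq_left (zero_le (a := ENNReal.ofReal r)), ← ENNReal.ofReal_zero, ← ENNReal.ofReal_max,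
      ENNReal.le_ofReal_iff_toReal_le (Metric.infEDist_ne_top p.1.nonempty) (le_max_right r 0),
      Metric.infDist]
  rw [this]
  exact isClosed_le hc continuous_const

theorem isClosed_setOf_mem :
    IsClosed {p : Grain d × Space d | p.2 ∈ (p.1 : Set (Space d))} := by
  have := isClosed_setOf_mem_cthickening (d := d) 0
  simpa only [Metric.cthickening_zero, fun p : Grain d × Space d =>
    p.1.isCompact.isClosed.closure_eq] using this

/-- The center of gravity of a measurably varying set depends measurably on the parameter. -/
theorem measurable_setAverage {T : Grain d → Set (Space d)}
    (hT : MeasurableSet {p : Grain d × Space d | p.2 ∈ T p.1}) :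
    Measurable fun K => ⨍ y in T K, y := by
  have hTK : ∀ K, MeasurableSet (T K) := fun K => measurable_prodMk_left hT
  simp_rw [setAverage_eq]
  have h1 : Measurable fun K => volume.real (T K) :=
    (measurable_measure_prodMk_left (ν := (volume : Measure (Space d))) hT).ennreal_toReal
  have h2 : Measurable fun K => ∫ y in T K, y := by
    simp_rw [← integral_indicator (hTK _)]
    have : StronglyMeasurable fun p : Grain d × Space d =>
        {p : Grain d × Space d | p.2 ∈ T p.1}.indicator (fun p => p.2) p :=
      (measurable_snd.indicator hT).stronglyMeasurable
    exact this.integral_prod_right.measurable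
  exact h1.inv.smul h2

theorem measurable_parallelCentroid (r : ℝ) :
    Measurable fun K : Grain d => K.parallelCentroid r :=
  measurable_setAverage (isClosed_setOf_mem_cthickening r).measurableSet

theorem measurable_center : Measurable (Grain.center : Grain d → Space d) := by
  classical
  have hlim : ∀ K : Grain d, Grain.center K =
      if volume (K : Set (Space d)) ≠ 0 then ⨍ y in (K : Set (Space d)), y
      else if ∃ z, Tendsto (fun n : ℕ => K.parallelCentroid (1 / ((n : ℝ) + 1))) atTop (𝓝 z) then
        limUnder atTop fun n : ℕ => K.parallelCentroid (1 / ((n : ℝ) + 1))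
      else K.parallelCentroid 1 := by
    intro K
    unfold Grain.center
    split_ifs with h1 h2 <;> first | rfl | exact h2.choose_spec.limUnder_eq.symm
  have hm : ∀ n : ℕ, StronglyMeasurable fun K : Grain d =>
      K.parallelCentroid (1 / ((n : ℝ) + 1)) :=
    fun n => (measurable_parallelCentroid _).stronglyMeasurable
  rw [show (Grain.center : Grain d → Space d) = _ from funext hlim]
  refine Measurable.ite ?_ (measurable_setAverage isClosed_setOf_mem.measurableSet)
    (Measurable.ite ?_ ?_ (measurable_parallelCentroid 1))
  · exact (measurable_measure_prodMk_left (ν := (volume : Measure (Space d)))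
      isClosed_setOf_mem.measurableSet) (measurableSet_singleton 0).compl
  · exact StronglyMeasurable.measurableSet_exists_tendsto hm
  · exact (StronglyMeasurable.limUnder hm).measurable

theorem setAverage_image_add (x : Space d) {T : Set (Space d)} (hT : IsCompact T)
    (h0 : volume T ≠ 0) : ⨍ y in (fun y => x + y) '' T, y = x + ⨍ y in T, y := by
  have hfin : volume T ≠ ∞ := hT.measure_lt_top.ne
  have hvol : volume.real T ≠ 0 := by
    rw [Measure.real, ENNReal.toReal_ne_zero]
    exact ⟨h0, hfin⟩
  have hpres := measurePreserving_add_left (volume : Measure (Space d)) x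
  rw [setAverage_eq, setAverage_eq,
    hpres.setIntegral_image_emb (measurableEmbedding_addLeft x) (fun y => y) T, measureReal_def,
    image_add_left, measure_preimage_add, ← measureReal_def,
    integral_add (f := fun _ => x) (g := fun y => y)
      (integrableOn_const hfin : IntegrableOn (fun _ => x) T volume)
      (continuousOn_id.integrableOn_compact hT : IntegrableOn (fun y => y) T volume),
    setIntegral_const, smul_add, smul_smul, inv_mul_cancel₀ hvol, one_smul]

theorem cthickening_translate (x : Space d) (K : Grain d) (r : ℝ) :
    Metric.cthickening r (K.translate x : Set (Space d)) =
      (fun y => x + y) '' Metric.cthickening r (K : Set (Space d)) := by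
  have hd : ∀ y, Metric.infEDist (x + y) ((fun y => x + y) '' (K : Set (Space d))) =
      Metric.infEDist y (K : Set (Space d)) := fun y =>
    Metric.infEDist_image (isometry_add_left x)
  ext z
  rw [coe_translate, image_add_left (t := Metric.cthickening r _), mem_preimage,
    Metric.mem_cthickening_iff, Metric.mem_cthickening_iff, ← hd, add_neg_cancel_left]

theorem parallelCentroid_translate (x : Space d) (K : Grain d) {r : ℝ} (hr : 0 < r) :
    (K.translate x).parallelCentroid r = x + K.parallelCentroid r := by
  unfold Grain.parallelCentroid
  rw [cthickening_translate]
  refine setAverage_image_add x (K.isCompact.cthickening) ?_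
  obtain ⟨y, hy⟩ := K.nonempty
  have hsub : Metric.ball y r ⊆ Metric.cthickening r (K : Set (Space d)) :=
    (Metric.ball_subset_thickening hy r).trans (Metric.thickening_subset_cthickening r _)
  exact fun h0 => (Metric.measure_ball_pos volume y hr).ne' (measure_mono_null hsub h0)

/-- The center of gravity is translation covariant for every grain, including the null sets whose
parallel sets have no limiting center. -/
theorem center_translate (x : Space d) (K : Grain d) :
    (K.translate x).center = x + K.center := by
  have hvol : volume (K.translate x : Set (Space d)) = volume (K : Set (Space d)) := by
    rw [coe_translate, image_add_left, measure_preimage_add]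
  have hpc : ∀ n : ℕ, (K.translate x).parallelCentroid (1 / ((n : ℝ) + 1)) =
      x + K.parallelCentroid (1 / ((n : ℝ) + 1)) := fun n =>
    parallelCentroid_translate x K (by positivity)
  unfold Grain.center
  rw [hvol]
  by_cases h0 : volume (K : Set (Space d)) ≠ 0
  · rw [if_pos h0, if_pos h0, coe_translate, setAverage_image_add x K.isCompact h0]
  rw [if_neg h0, if_neg h0]
  by_cases hz : ∃ z, Tendsto (fun n : ℕ => K.parallelCentroid (1 / ((n : ℝ) + 1))) atTop (𝓝 z)
  · have hz' : ∃ z, Tendsto (fun n : ℕ => (K.translate x).parallelCentroid (1 / ((n : ℝ) + 1)))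
        atTop (𝓝 z) := by
      simp only [hpc]
      exact hz.imp' (x + ·) fun z h => h.const_add x
    rw [dif_pos hz, dif_pos hz']
    refine tendsto_nhds_unique hz'.choose_spec ?_
    simp only [hpc]
    exact hz.choose_spec.const_add x
  · have hz' : ¬ ∃ z, Tendsto
        (fun n : ℕ => (K.translate x).parallelCentroid (1 / ((n : ℝ) + 1))) atTop (𝓝 z) := by
      simp only [hpc]
      exact fun ⟨z, h⟩ => hz ⟨-x + z, by simpa using h.const_add (-x)⟩
    rw [dif_neg hz, dif_neg hz', parallelCentroid_translate x K one_pos]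

end Grain

/-! ### Configurations as counting measures -/

namespace Config

variable {d : ℕ}

@[ext]
theorem ext_grains {φ ψ : Config d} (h : φ.grains = ψ.grains) : φ = ψ := by
  cases φ
  cases ψ
  congr

/-- The grains that meet the closed ball of radius `n` about the origin, but not the one of
radius `n - 1`. These sets partition the space of grains. -/
def shell (d n : ℕ) : Set (Grain d) :=
  disjointed (fun n : ℕ =>
    {K : Grain d | ((K : Set (Space d)) ∩ Metric.closedBall 0 n).Nonempty}) n

theorem measurableSet_shell (n : ℕ) : MeasurableSet (shell d n) :=
  MeasurableSet.disjointed (fun _ => Grain.measurableSet_hit Metric.isClosed_closedBall) n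

theorem pairwise_disjoint_shell : Pairwise (Function.onFun Disjoint (shell d)) :=
  disjoint_disjointed _

theorem iUnion_shell : ⋃ n, shell d n = univ := by
  unfold shell
  rw [iUnion_disjointed]
  refine eq_univ_of_forall fun K => mem_iUnion.2 ?_
  obtain ⟨y, hy⟩ := K.nonempty
  obtain ⟨n, hn⟩ := exists_nat_ge ‖y‖
  exact ⟨n, y, hy, by simpa using hn⟩

theorem finite_inter_shell (φ : Config d) (n : ℕ) : (φ.grains ∩ shell d n).Finite :=
  (φ.locallyFinite _ (isCompact_closedBall 0 (n : ℝ))).subset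
    fun _ hK => ⟨hK.1, disjointed_subset _ _ hK.2⟩

theorem countable_grains (φ : Config d) : φ.grains.Countable := by
  rw [← inter_univ φ.grains, ← iUnion_shell, inter_iUnion]
  exact countable_iUnion fun n => (φ.finite_inter_shell n).countable

theorem measurableSet_grains (φ : Config d) : MeasurableSet φ.grains :=
  φ.countable_grains.measurableSet

theorem toMeasure_eq (φ : Config d) : φ.toMeasure = Measure.count.restrict φ.grains := by
  ext A hA
  have := φ.countable_grains.to_subtype
  rw [Config.toMeasure, Measure.sum_apply _ hA, Measure.restrict_apply hA,
    ← lintegral_indicator_one (hA.inter φ.measurableSet_grains),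
    lintegral_count, ← tsum_subtype_eq_of_support_subset (s := φ.grains)]
  · refine tsum_congr fun K => ?_
    rw [Measure.dirac_apply' _ hA]
    by_cases hK : (K : Grain d) ∈ A
    · simp [hK]
    · simp [hK]
  · intro K hK
    by_contra h
    exact hK (indicator_of_notMem (fun h' => h h'.2) _)

theorem toMeasure_apply (φ : Config d) {A : Set (Grain d)} (hA : MeasurableSet A) :
    φ.toMeasure A = (φ.grains ∩ A).encard := by
  rw [toMeasure_eq, Measure.restrict_apply hA, inter_comm,
    Measure.count_apply (φ.measurableSet_grains.inter hA)]

theorem setLIntegral_toMeasure (φ : Config d) (f : Grain d → ℝ≥0∞) {A : Set (Grain d)}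
    (hA : MeasurableSet A) :
    ∫⁻ K in A, f K ∂φ.toMeasure = ∫⁻ K in φ.grains ∩ A, f K ∂Measure.count := by
  rw [toMeasure_eq, Measure.restrict_restrict hA, inter_comm]

theorem measurable_toMeasure : Measurable (Config.toMeasure : Config d → Measure (Grain d)) :=
  comap_measurable _

theorem measurable_iff {Ω : Type*} [MeasurableSpace Ω] {X : Ω → Config d} :
    Measurable X ↔ ∀ A, MeasurableSet A → Measurable fun ω => (X ω).toMeasure A := by
  rw [measurable_comap_iff]
  exact ⟨fun h A hA => (Measure.measurable_coe hA).comp h,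
    fun h => Measure.measurable_of_measurable_coe _ h⟩

theorem measurable_apply {A : Set (Grain d)} (hA : MeasurableSet A) :
    Measurable fun φ : Config d => φ.toMeasure A :=
  (Measure.measurable_coe hA).comp measurable_toMeasure

/-- The kernel that sends a configuration to its counting measure. -/
noncomputable def kernel (d : ℕ) : ProbabilityTheory.Kernel (Config d) (Grain d) :=
  ⟨Config.toMeasure, measurable_toMeasure⟩

/-- The restriction of the counting measure to a shell, cut off where it has not exactly `k`
points there. -/
noncomputable def shellKernel (d n k : ℕ) : ProbabilityTheory.Kernel (Config d) (Grain d) := by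
  classical
  exact ProbabilityTheory.Kernel.piecewise
    (measurable_apply (measurableSet_shell n) (measurableSet_singleton (k : ℝ≥0∞)))
    ((kernel d).restrict (measurableSet_shell n)) 0

theorem shellKernel_apply (n k : ℕ) (φ : Config d) [Decidable (φ.toMeasure (shell d n) = k)] :
    shellKernel d n k φ =
      if φ.toMeasure (shell d n) = k then φ.toMeasure.restrict (shell d n) else 0 := by
  classical
  rw [shellKernel, ProbabilityTheory.Kernel.piecewise_apply]
  simp only [mem_preimage, mem_singleton_iff, _root_.zero_apply]
  by_cases h : φ.toMeasure (shell d n) = k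
  · rw [if_pos h, if_pos h]
    rfl
  · rw [if_neg h, if_neg h]

theorem isFiniteKernel_shellKernel (n k : ℕ) :
    ProbabilityTheory.IsFiniteKernel (shellKernel d n k) := by
  classical
  refine ⟨⟨k, ENNReal.natCast_lt_top k, fun φ => ?_⟩⟩
  rw [shellKernel_apply]
  split_ifs with h
  · rw [Measure.restrict_apply_univ, h]
  · simp

/-- Counting measures of configurations depend on the configuration through an s-finite kernel;
this is what gives joint measurability of integrals that contain a configuration and another
parameter. -/
instance isSFiniteKernel_kernel : ProbabilityTheory.IsSFiniteKernel (kernel d) := by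
  classical
  have hfin := isFiniteKernel_shellKernel (d := d)
  have hsum : kernel d = ProbabilityTheory.Kernel.sum fun n =>
      ProbabilityTheory.Kernel.sum fun k => shellKernel d n k := by
    ext φ : 1
    rw [ProbabilityTheory.Kernel.sum_apply]
    simp only [ProbabilityTheory.Kernel.sum_apply, shellKernel_apply]
    have hn : ∀ n, Measure.sum (fun k : ℕ => if φ.toMeasure (shell d n) = k then
        φ.toMeasure.restrict (shell d n) else 0) = φ.toMeasure.restrict (shell d n) := by
      intro n
      ext A hA
      obtain ⟨m, hm⟩ : ∃ m : ℕ, φ.toMeasure (shell d n) = m := by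
        rw [toMeasure_apply φ (measurableSet_shell n),
          (φ.finite_inter_shell n).encard_eq_coe_toFinset_card]
        exact ⟨_, rfl⟩
      rw [Measure.sum_apply _ hA, tsum_eq_single m]
      · rw [if_pos hm]
      · intro k hk
        rw [if_neg]
        · rfl
        · rw [hm]
          exact fun h => hk (by exact_mod_cast h.symm)
    simp only [hn]
    rw [← Measure.restrict_iUnion pairwise_disjoint_shell measurableSet_shell, iUnion_shell,
      Measure.restrict_univ]
    rfl
  rw [hsum]
  infer_instance

theorem measurable_lintegral {Ω : Type*} [MeasurableSpace Ω] {X : Ω → Config d}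
    (hX : Measurable X) {f : Ω → Grain d → ℝ≥0∞} (hf : Measurable (Function.uncurry f)) :
    Measurable fun ω => ∫⁻ K, f ω K ∂(X ω).toMeasure := by
  have h := Measurable.lintegral_kernel_prod_right
    (κ := (kernel d).comap X hX) (f := f) hf
  exact h

theorem measurable_setLIntegral {f : Grain d → ℝ≥0∞} (hf : Measurable f) {A : Set (Grain d)}
    (hA : MeasurableSet A) : Measurable fun φ : Config d => ∫⁻ K in A, f K ∂φ.toMeasure := by
  simp_rw [← lintegral_indicator hA]
  exact measurable_lintegral measurable_id ((hf.indicator hA).comp measurable_snd)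

theorem translate_grains (x : Space d) (φ : Config d) :
    (φ.translate x).grains = Grain.translate x '' φ.grains :=
  rfl

theorem mem_translate {x : Space d} {φ : Config d} {K : Grain d} :
    K ∈ (φ.translate x).grains ↔ K.translate (-x) ∈ φ.grains := by
  rw [translate_grains]
  constructor
  · rintro ⟨L, hL, rfl⟩
    simpa using hL
  · exact fun h => ⟨_, h, by simp⟩

theorem translate_translate (x y : Space d) (φ : Config d) :
    (φ.translate y).translate x = φ.translate (x + y) := by
  ext K
  rw [mem_translate, mem_translate, mem_translate, Grain.translate_translate, neg_add_rev]

@[simp]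
theorem translate_zero (φ : Config d) : φ.translate 0 = φ := by
  ext K
  rw [mem_translate, neg_zero, Grain.translate_zero]

theorem toMeasure_translate (x : Space d) (φ : Config d) :
    (φ.translate x).toMeasure = φ.toMeasure.map (Grain.translate x) := by
  ext A hA
  have hx := Grain.measurable_translate_left x
  rw [Measure.map_apply hx hA, toMeasure_apply _ hA, toMeasure_apply _ (hx hA),
    translate_grains, ← image_inter_preimage,
    (Grain.translate_injective x).injOn.encard_image]

theorem measurable_translate :
    Measurable fun p : Space d × Config d => p.2.translate p.1 := by
  rw [measurable_iff]
  intro A hA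
  have : ∀ p : Space d × Config d, (p.2.translate p.1).toMeasure A =
      ∫⁻ K, A.indicator 1 (K.translate p.1) ∂p.2.toMeasure := by
    intro p
    have hx := Grain.measurable_translate_left p.1
    rw [toMeasure_translate, ← lintegral_map (measurable_one.indicator hA) hx,
      lintegral_indicator_one hA]
  simp_rw [this]
  refine measurable_lintegral measurable_snd ?_
  exact (measurable_one.indicator hA).comp
    (Grain.measurable_translate.comp (measurable_fst.fst.prodMk measurable_snd))

theorem measurable_translate_left (x : Space d) :
    Measurable (Config.translate x : Config d → Config d) :=
  measurable_translate.comp (measurable_const.prodMk measurable_id)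

end Config

/-- Two grains with overlapping interiors contain a common closed ball with rational radius and
center in a fixed countable dense set. Hence the hard-core constraint says that each of these
countably many balls is contained in at most one particle. -/
theorem isHardCore_iff {d : ℕ} (s : Set (Grain d)) :
    IsHardCore s ↔ ∀ (n m : ℕ), (s ∩ {K : Grain d |
      Metric.closedBall (TopologicalSpace.denseSeq (Space d) n) (1 / ((m : ℝ) + 1)) ⊆
        (K : Set (Space d))}).encard ≤ 1 := by
  simp only [encard_le_one_iff]
  constructor
  · rintro h n m K L ⟨hK, hBK⟩ ⟨hL, hBL⟩
    by_contra hne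
    have hx : ∀ {M : Grain d}, Metric.closedBall (TopologicalSpace.denseSeq (Space d) n)
        (1 / ((m : ℝ) + 1)) ⊆ (M : Set (Space d)) →
        TopologicalSpace.denseSeq (Space d) n ∈ interior (M : Set (Space d)) := fun hM =>
      mem_interior.2 ⟨_, Metric.ball_subset_closedBall.trans hM, Metric.isOpen_ball,
        Metric.mem_ball_self (by positivity)⟩
    exact disjoint_left.1 (h hK hL hne) (hx hBK) (hx hBL)
  · intro h K hK L hL hne
    rw [disjoint_left]
    intro x hxK hxL
    have hU : interior (K : Set (Space d)) ∩ interior (L : Set (Space d)) ∈ 𝓝 x :=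
      (isOpen_interior.inter isOpen_interior).mem_nhds ⟨hxK, hxL⟩
    obtain ⟨ε, hε, hsub⟩ := Metric.mem_nhds_iff.1 hU
    obtain ⟨m, hm⟩ := exists_nat_one_div_lt (half_pos hε)
    obtain ⟨n, hn⟩ := (TopologicalSpace.denseRange_denseSeq (Space d)).exists_dist_lt x
      (half_pos hε)
    have hball : Metric.closedBall (TopologicalSpace.denseSeq (Space d) n) (1 / ((m : ℝ) + 1)) ⊆
        interior (K : Set (Space d)) ∩ interior (L : Set (Space d)) := by
      refine subset_trans (fun y hy => ?_) hsub
      rw [Metric.mem_closedBall] at hy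
      rw [Metric.mem_ball]
      rw [dist_comm] at hn
      linarith [dist_triangle y (TopologicalSpace.denseSeq (Space d) n) x]
    exact hne (h n m K L ⟨hK, fun y hy => interior_subset (hball hy).1⟩
      ⟨hL, fun y hy => interior_subset (hball hy).2⟩)

/-- The hard-core property of a random set of grains is an event as soon as the number of its
members in each measurable set is a random variable. -/
theorem measurableSet_isHardCore {d : ℕ} {Ω : Type*} [MeasurableSpace Ω] {s : Ω → Set (Grain d)}
    (hs : ∀ A, MeasurableSet A → Measurable fun ω => ((s ω ∩ A).encard : ℝ≥0∞)) :
    MeasurableSet {ω | IsHardCore (s ω)} := by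
  simp only [isHardCore_iff, ofPred_forall]
  refine MeasurableSet.iInter fun n => MeasurableSet.iInter fun m => ?_
  have := hs _ (Grain.isClosed_setOf_superset
    (Metric.closedBall (TopologicalSpace.denseSeq (Space d) n) (1 / ((m : ℝ) + 1)))).measurableSet
    (measurableSet_Iic (a := 1))
  convert this using 1
  ext ω
  simp only [mem_ofPred_eq, mem_preimage, mem_Iic]
  rw [← ENat.toENNReal_one, ENat.toENNReal_le]

theorem IsHardCore.translate {d : ℕ} {s : Set (Grain d)} (hs : IsHardCore s) (x : Space d) :
    IsHardCore (Grain.translate x '' s) := by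
  rintro _ ⟨K, hK, rfl⟩ _ ⟨L, hL, rfl⟩ hne
  rw [Grain.interior_translate, Grain.interior_translate]
  exact (disjoint_image_iff (add_right_injective x)).2
    (hs hK hL fun h => hne (by rw [h]))

/-! ### Cubes -/

section Cube

variable {d : ℕ}

theorem cube_eq_preimage (a b : ℝ) :
    cube d a b = WithLp.ofLp ⁻¹' (Icc (fun _ => a) fun _ => b : Set (Fin d → ℝ)) := by
  ext x
  simp only [cube, mem_ofPred_eq, mem_preimage, mem_Icc, Pi.le_def]
  exact forall_and

theorem volume_cube (a b : ℝ) : volume (cube d a b) = ENNReal.ofReal (b - a) ^ d := by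
  rw [cube_eq_preimage, (PiLp.volume_preserving_ofLp (Fin d)).measure_preimage
    measurableSet_Icc.nullMeasurableSet, Real.volume_Icc_pi]
  simp

theorem isClosed_cube (a b : ℝ) : IsClosed (cube d a b) := by
  rw [cube_eq_preimage]
  exact isClosed_Icc.preimage (PiLp.continuous_ofLp 2 _)

theorem isCompact_cube (a b : ℝ) : IsCompact (cube d a b) := by
  have : cube d a b = WithLp.toLp 2 '' (Icc (fun _ => a) fun _ => b : Set (Fin d → ℝ)) := by
    rw [cube_eq_preimage]
    ext x
    exact ⟨fun h => ⟨_, h, rfl⟩, by rintro ⟨y, hy, rfl⟩; exact hy⟩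
  rw [this]
  exact isCompact_Icc.image (PiLp.continuous_toLp 2 _)

theorem measurableSet_cube (a b : ℝ) : MeasurableSet (cube d a b) :=
  (isClosed_cube a b).measurableSet

theorem nonempty_interior_cube {a b : ℝ} (hab : a < b) : (interior (cube d a b)).Nonempty := by
  refine ⟨WithLp.toLp 2 fun _ => (a + b) / 2, mem_interior.2
    ⟨WithLp.ofLp ⁻¹' (Set.pi univ fun _ => Ioo a b), ?_, ?_, ?_⟩⟩
  · intro x hx i
    exact Ioo_subset_Icc_self (hx i (mem_univ i))
  · exact (isOpen_set_pi finite_univ fun _ _ => isOpen_Ioo).preimage (PiLp.continuous_ofLp 2 _)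
  · intro i _
    constructor <;> simp only <;> linarith

end Cube

/-! ### Campbell's formula and the `h`-intensity -/

section Campbell

variable {d : ℕ} {Ω : Type u} [MeasurableSpace Ω] {P : Measure Ω} {X : Ω → Config d}

theorem lintegral_intensityMeasure (hX : Measurable X) {f : Grain d → ℝ≥0∞} (hf : Measurable f) :
    ∫⁻ K, f K ∂intensityMeasure P X = ∫⁻ ω, ∫⁻ K, f K ∂(X ω).toMeasure ∂P :=
  Measure.lintegral_bind (Config.measurable_toMeasure.comp hX).aemeasurable hf.aemeasurable

theorem setLIntegral_intensityMeasure (hX : Measurable X) {f : Grain d → ℝ≥0∞}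
    (hf : Measurable f) {A : Set (Grain d)} (hA : MeasurableSet A) :
    ∫⁻ K in A, f K ∂intensityMeasure P X = ∫⁻ ω, ∫⁻ K in A, f K ∂(X ω).toMeasure ∂P := by
  simp_rw [← lintegral_indicator hA]
  exact lintegral_intensityMeasure hX (hf.indicator hA)

theorem intensityMeasure_apply (hX : Measurable X) {A : Set (Grain d)} (hA : MeasurableSet A) :
    intensityMeasure P X A = ∫⁻ ω, (X ω).toMeasure A ∂P :=
  Measure.bind_apply hA (Config.measurable_toMeasure.comp hX).aemeasurable

theorem measurableSet_center {B : Set (Space d)} (hB : MeasurableSet B) :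
    MeasurableSet {K : Grain d | K.center ∈ B} :=
  Grain.measurable_center hB

theorem intensity_eq (hX : Measurable X) :
    intensity P X = intensityMeasure P X {K | K.center ∈ cube d 0 1} :=
  (intensityMeasure_apply hX (measurableSet_center (measurableSet_cube 0 1))).symm

theorem IsStationary.map_intensityMeasure (hstat : IsStationary P X) (hX : Measurable X)
    (x : Space d) : (intensityMeasure P X).map (Grain.translate x) = intensityMeasure P X := by
  ext A hA
  have hx := Grain.measurable_translate_left x
  have hm := Config.measurable_apply hA
  rw [Measure.map_apply hx hA, intensityMeasure_apply hX (hx hA), intensityMeasure_apply hX hA]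
  calc ∫⁻ ω, (X ω).toMeasure (Grain.translate x ⁻¹' A) ∂P
      = ∫⁻ ω, ((X ω).translate x).toMeasure A ∂P := by
        simp_rw [Config.toMeasure_translate, Measure.map_apply hx hA]
    _ = ∫⁻ φ, φ.toMeasure A ∂(P.map fun ω => (X ω).translate x) :=
        (lintegral_map hm ((Config.measurable_translate_left x).comp hX)).symm
    _ = ∫⁻ ω, (X ω).toMeasure A ∂P := by rw [hstat x, lintegral_map hm hX]

/-- The shift `K - c(K)` that moves the center of gravity to the origin. -/
noncomputable def Grain.centered (K : Grain d) : Grain d :=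
  K.translate (-K.center)

theorem Grain.measurable_centered : Measurable (Grain.centered : Grain d → Grain d) :=
  Grain.measurable_translate.comp (Grain.measurable_center.neg.prodMk measurable_id)

theorem Grain.centered_translate (x : Space d) (K : Grain d) :
    (K.translate x).centered = K.centered := by
  unfold Grain.centered
  rw [Grain.center_translate, Grain.translate_translate, neg_add_rev, neg_add_cancel_right]

theorem Grain.center_centered (K : Grain d) : K.centered.center = 0 := by
  unfold Grain.centered
  rw [Grain.center_translate, neg_add_cancel]

theorem Grain.translate_centered (K : Grain d) : K.centered.translate K.center = K := by
  simp [Grain.centered]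

/-- The typical grain distribution before normalization, a measure of total mass equal to the
intensity. -/
noncomputable def grainMeasure (P : Measure Ω) (X : Ω → Config d) : Measure (Grain d) :=
  ((intensityMeasure P X).restrict {K | K.center ∈ cube d 0 1}).map Grain.centered

theorem typicalGrain_eq : typicalGrain P X = (intensity P X)⁻¹ • grainMeasure P X :=
  rfl

theorem grainMeasure_univ (hX : Measurable X) : grainMeasure P X univ = intensity P X := by
  rw [grainMeasure, Measure.map_apply Grain.measurable_centered .univ, preimage_univ,
    Measure.restrict_apply_univ, intensity_eq hX]

/-- Multiplying the typical grain distribution by the intensity gives back the unnormalized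
measure, also when the intensity vanishes. -/
theorem intensity_mul_lintegral_typicalGrain (hX : Measurable X) (hfin : intensity P X ≠ ∞)
    (f : Grain d → ℝ≥0∞) :
    intensity P X * ∫⁻ K, f K ∂typicalGrain P X = ∫⁻ K, f K ∂grainMeasure P X := by
  by_cases h0 : intensity P X = 0
  · rw [h0, zero_mul, Measure.measure_univ_eq_zero.1 ((grainMeasure_univ hX).trans h0),
      lintegral_zero_measure]
  · rw [typicalGrain_eq, lintegral_smul_measure, smul_eq_mul, ← mul_assoc,
      ENNReal.mul_inv_cancel h0 hfin, one_mul]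

theorem ae_center_eq_zero : ∀ᵐ K ∂grainMeasure P X, K.center = 0 := by
  refine (ae_map_iff Grain.measurable_centered.aemeasurable
    (Grain.measurable_center (measurableSet_singleton 0))).2 ?_
  exact Eventually.of_forall Grain.center_centered

/-- Centers and centered grains of a stationary particle process are independent with respect to
its intensity measure: the image measure is the product of Lebesgue measure and the unnormalized
typical grain distribution. -/
theorem map_center_centered (hstat : IsStationary P X) (hX : Measurable X)
    (hfin : intensity P X ≠ ∞) :
    (intensityMeasure P X).map (fun K => (K.center, K.centered)) =
      (volume : Measure (Space d)).prod (grainMeasure P X) := by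
  have hpair : Measurable fun K : Grain d => (K.center, K.centered) :=
    Grain.measurable_center.prodMk Grain.measurable_centered
  have : IsFiniteMeasure (grainMeasure P X) :=
    ⟨by rw [grainMeasure_univ hX]; exact hfin.lt_top⟩
  refine (Measure.prod_eq fun B D hB hD => ?_).symm
  rw [Measure.map_apply hpair (hB.prod hD)]
  -- For fixed `D`, the measure `B ↦ Λ {c ∈ B, K - c ∈ D}` is translation invariant.
  set μ : Measure (Space d) :=
    ((intensityMeasure P X).restrict (Grain.centered ⁻¹' D)).map Grain.center with hμ
  have hμB : ∀ {B : Set (Space d)}, MeasurableSet B → μ B =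
      intensityMeasure P X ((fun K : Grain d => (K.center, K.centered)) ⁻¹' (B ×ˢ D)) := by
    intro B hB
    rw [hμ, Measure.map_apply Grain.measurable_center hB,
      Measure.restrict_apply (Grain.measurable_center hB)]
    rfl
  have hcube : μ (cube d 0 1) = grainMeasure P X D := by
    rw [hμB (measurableSet_cube 0 1), grainMeasure, Measure.map_apply Grain.measurable_centered hD,
      Measure.restrict_apply (Grain.measurable_centered hD), inter_comm]
    rfl
  have hinv : μ.IsAddLeftInvariant := by
    rw [← forall_measure_preimage_add_iff]
    intro x B hB
    rw [hμB hB, hμB (measurable_const_add x hB)]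
    conv_rhs => rw [← hstat.map_intensityMeasure hX x]
    rw [Measure.map_apply (Grain.measurable_translate_left x) (hpair (hB.prod hD))]
    congr 1
    ext K
    simp only [mem_preimage, mem_prod, Grain.center_translate, Grain.centered_translate]
  have hcompact : IsFiniteMeasureOnCompacts μ := by
    refine ⟨fun {C} hC => measure_lt_top_of_isCompact_of_isAddLeftInvariant'
      (nonempty_interior_cube (d := d) zero_lt_one) ?_ hC⟩
    rw [hcube]
    exact measure_ne_top _ _
  obtain ⟨c, hHaar⟩ : ∃ c : ℝ≥0, μ = c • (volume : Measure (Space d)) :=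
    ⟨_, Measure.isAddLeftInvariant_eq_smul μ volume⟩
  have hc : grainMeasure P X D = c := by
    rw [← hcube, hHaar]
    simp [volume_cube]
  rw [← hμB hB, hHaar, hc, mul_comm]
  simp

/-- Campbell's formula for a stationary particle process. -/
theorem campbell (hstat : IsStationary P X) (hX : Measurable X) (hfin : intensity P X ≠ ∞)
    {f : Grain d → ℝ≥0∞} (hf : Measurable f) :
    ∫⁻ K, f K ∂intensityMeasure P X =
      ∫⁻ K, ∫⁻ x, f (K.translate x) ∂(volume : Measure (Space d)) ∂grainMeasure P X := by
  have : IsFiniteMeasure (grainMeasure P X) :=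
    ⟨by rw [grainMeasure_univ hX]; exact hfin.lt_top⟩
  have hg : Measurable fun p : Space d × Grain d => f (p.2.translate p.1) :=
    hf.comp Grain.measurable_translate
  rw [← lintegral_prod_symm _ hg.aemeasurable, ← map_center_centered hstat hX hfin,
    lintegral_map hg (Grain.measurable_center.prodMk Grain.measurable_centered)]
  simp only [Grain.translate_centered]

variable {h : Grain d → ℝ≥0}

theorem hIntensity_eq (hX : Measurable X) (hfin : intensity P X ≠ ∞) :
    hIntensity h P X = ∫⁻ K, (h K : ℝ≥0∞) ∂grainMeasure P X :=
  intensity_mul_lintegral_typicalGrain hX hfin _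

/-- The particles with center in `B` carry expected total `h`-value `γ_h λ_d(B)`. -/
theorem setLIntegral_center (hstat : IsStationary P X) (hX : Measurable X)
    (hfin : intensity P X ≠ ∞) (hmeas : Measurable h)
    (hinv : ∀ (x : Space d) (K : Grain d), h (K.translate x) = h K)
    {B : Set (Space d)} (hB : MeasurableSet B) :
    ∫⁻ ω, ∫⁻ K in {K | K.center ∈ B}, h K ∂(X ω).toMeasure ∂P =
      hIntensity h P X * volume B := by
  have hm : Measurable fun K => (h K : ℝ≥0∞) := hmeas.coe_nnreal_ennreal
  rw [← setLIntegral_intensityMeasure hX hm (measurableSet_center hB),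
    ← lintegral_indicator (measurableSet_center hB),
    campbell hstat hX hfin (hm.indicator (measurableSet_center hB)), hIntensity_eq hX hfin,
    ← lintegral_mul_const _ hm]
  refine lintegral_congr_ae ?_
  filter_upwards [ae_center_eq_zero (P := P) (X := X)] with K hK
  rw [← lintegral_indicator_const hB]
  refine lintegral_congr fun x => ?_
  by_cases hx : x ∈ B
  · rw [indicator_of_mem hx, indicator_of_mem, hinv]
    rwa [mem_ofPred_eq, Grain.center_translate, hK, add_zero]
  · rw [indicator_of_notMem hx, indicator_of_notMem]
    rwa [mem_ofPred_eq, Grain.center_translate, hK, add_zero]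

end Campbell

/-! ### Tilings of space by translates of a bounded cell -/

section Tile

variable {d : ℕ}

/-- The translates of `W` under the group `G` tile `ℝ^d`, and `W` has positive finite volume. -/
structure IsTile (G : AddSubgroup (Space d)) (W : Set (Space d)) : Prop where
  measurableSet : MeasurableSet W
  existsUnique : ∀ x : Space d, ∃! g : G, (g : Space d) + x ∈ W
  volume_ne_zero : volume W ≠ 0
  volume_ne_top : volume W ≠ ∞

namespace IsTile

variable {G : AddSubgroup (Space d)} {W : Set (Space d)}

theorem eq_zero_of_mem (hW : IsTile G W) {g x : Space d} (hg : g ∈ G) (hx : x ∈ W)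
    (hgx : g + x ∈ W) : g = 0 := by
  have := (hW.existsUnique x).unique (y₁ := ⟨g, hg⟩) (y₂ := 0) hgx (by simpa using hx)
  exact congrArg Subtype.val this

theorem isAddFundamentalDomain (hW : IsTile G W) (μ : Measure (Space d)) :
    IsAddFundamentalDomain G W μ :=
  .mk' hW.measurableSet.nullMeasurableSet hW.existsUnique

theorem preimage_add (hW : IsTile G W) (x : Space d) : IsTile G ((fun y => y + x) ⁻¹' W) where
  measurableSet := measurable_add_const x hW.measurableSet
  existsUnique y := by
    simp only [mem_preimage, add_assoc]
    exact hW.existsUnique (y + x)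
  volume_ne_zero := by
    rw [measure_preimage_add_right]
    exact hW.volume_ne_zero
  volume_ne_top := by
    rw [measure_preimage_add_right]
    exact hW.volume_ne_top

/-- The integral of a `G`-periodic function over a cell does not change under shifts. -/
theorem setLIntegral_add_right [Countable G] (hW : IsTile G W) {k : Space d → ℝ≥0∞}
    (hk : ∀ g ∈ G, ∀ x, k (g + x) = k x) (x : Space d) :
    ∫⁻ u in W, k (u + x) = ∫⁻ u in W, k u := by
  have h1 : ∫⁻ u in W, k (u + x) =
      ∫⁻ u in (fun y => y + -x) ⁻¹' W, k u := by
    have hpre := (measurePreserving_add_right (volume : Measure (Space d)) x).setLIntegral_comp_emb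
      (measurableEmbedding_addRight x) k W
    rw [hpre, image_add_right]
  rw [h1]
  exact ((hW.preimage_add (-x)).isAddFundamentalDomain volume).setLIntegral_eq
    (hW.isAddFundamentalDomain volume) k fun g y => hk g g.2 y

end IsTile

/-- There are tilings with bounded cells that contain a given ball: scale the lattice `ℤ^d` by `2R`
and use half-open cubes centered at lattice points. -/
theorem exists_isTile (d : ℕ) {R : ℝ} (hR : 0 < R) :
    ∃ (G : AddSubgroup (Space d)) (W : Set (Space d)),
      Countable G ∧ IsTile G W ∧ Bornology.IsBounded W ∧ Metric.ball 0 R ⊆ W := by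
  have hu : ∀ _ : Fin d, IsUnit (2 * R) := fun _ => IsUnit.mk0 _ (by positivity)
  let b : Module.Basis (Fin d) ℝ (Space d) :=
    (EuclideanSpace.basisFun (Fin d) ℝ).toBasis.isUnitSMul hu
  have hrepr : ∀ (x : Space d) i, b.repr x i = (2 * R)⁻¹ * x i := by
    intro x i
    rw [Module.Basis.repr_isUnitSMul]
    simp [Units.smul_def]
  let v : Space d := WithLp.toLp 2 fun _ => R
  let D := ZSpan.fundamentalDomain b
  let G := (Submodule.span ℤ (range b)).toAddSubgroup
  let W : Set (Space d) := (fun y => y + v) ⁻¹' D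
  have hball : Metric.ball 0 R ⊆ W := by
    intro x hx i
    have hxi : |x i| < R := by
      rw [← Real.norm_eq_abs]
      exact (PiLp.norm_apply_le x i).trans_lt (by simpa using hx)
    have hvi : (x + v) i = x i + R := rfl
    rw [hrepr, hvi, mem_Ico, inv_mul_lt_iff₀ (by positivity)]
    have := abs_lt.1 hxi
    exact ⟨mul_nonneg (by positivity) (by linarith), by linarith⟩
  have hbdd : Bornology.IsBounded W :=
    (isometry_add_right v).antilipschitz.isBounded_preimage (ZSpan.fundamentalDomain_isBounded b)
  refine ⟨G, W, ?_, ⟨?_, ?_, ?_, ?_⟩, hbdd, hball⟩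
  · exact inferInstanceAs (Countable (Submodule.span ℤ (range b)))
  · exact measurable_add_const v (ZSpan.fundamentalDomain_measurableSet b)
  · intro x
    have := ZSpan.exist_unique_vadd_mem_fundamentalDomain b (x + v)
    simp only [Submodule.vadd_def, vadd_eq_add, ← add_assoc] at this
    exact this
  · exact fun h0 => (Metric.measure_ball_pos volume (0 : Space d) hR).ne'
      (measure_mono_null hball h0)
  · exact hbdd.measure_lt_top.ne

end Tile

/-! ### Elementary properties of thinnings -/

section Thinning

variable {d : ℕ} {Ω₀ : Type u} [MeasurableSpace Ω₀] {P₀ : Measure Ω₀} {Φ : Ω₀ → Config d}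

namespace HardCoreThinning

variable (T : HardCoreThinning P₀ Φ)

theorem measurable_base (hΦ : Measurable Φ) : Measurable fun ω => Φ (T.S ω) :=
  hΦ.comp T.measurePreserving_S.measurable

theorem lintegral_base (hΦ : Measurable Φ) {f : Config d → ℝ≥0∞} (hf : Measurable f) :
    ∫⁻ ω, f (Φ (T.S ω)) ∂T.P = ∫⁻ ω, f (Φ ω) ∂P₀ :=
  T.measurePreserving_S.lintegral_comp (hf.comp hΦ)

/-- Joint stationarity of `(Φ ∘ S, Ψ)` in terms of expectations. -/
theorem lintegral_translate (hΦ : Measurable Φ) (x : Space d)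
    {f : Config d × Config d → ℝ≥0∞} (hf : Measurable f) :
    ∫⁻ ω, f ((Φ (T.S ω)).translate x, (T.Ψ ω).translate x) ∂T.P =
      ∫⁻ ω, f (Φ (T.S ω), T.Ψ ω) ∂T.P := by
  have hx := Config.measurable_translate_left x
  have hΦS := T.measurable_base hΦ
  have hpair : Measurable fun ω => ((Φ (T.S ω)).translate x, (T.Ψ ω).translate x) :=
    (hx.comp hΦS).prodMk (hx.comp T.measurable_Ψ)
  rw [← lintegral_map hf hpair, T.jointlyStationary x, lintegral_map hf (hΦS.prodMk T.measurable_Ψ)]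

theorem isStationary (hΦ : Measurable Φ) : IsStationary T.P T.Ψ := by
  intro x
  refine Measure.ext_of_lintegral _ fun f hf => ?_
  have hx : Measurable fun ω => (T.Ψ ω).translate x :=
    (Config.measurable_translate_left x).comp T.measurable_Ψ
  rw [lintegral_map hf hx, lintegral_map hf T.measurable_Ψ]
  exact T.lintegral_translate hΦ x (hf.comp measurable_snd)

theorem toMeasure_le (ω : T.Ω) : (T.Ψ ω).toMeasure ≤ (Φ (T.S ω)).toMeasure := by
  rw [Config.toMeasure_eq, Config.toMeasure_eq]
  exact Measure.restrict_mono (T.subset ω) le_rfl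

theorem intensity_le (hΦ : Measurable Φ) : intensity T.P T.Ψ ≤ intensity P₀ Φ := by
  unfold intensity
  rw [← T.lintegral_base hΦ
    (Config.measurable_apply (measurableSet_center (measurableSet_cube 0 1)))]
  exact lintegral_mono fun ω => T.toMeasure_le ω _

theorem setLIntegral_le (hΦ : Measurable Φ) {f : Grain d → ℝ≥0∞} (hf : Measurable f)
    {A : Set (Grain d)} (hA : MeasurableSet A) :
    ∫⁻ ω, ∫⁻ K in A, f K ∂(T.Ψ ω).toMeasure ∂T.P ≤
      ∫⁻ ω, ∫⁻ K in A, f K ∂(Φ ω).toMeasure ∂P₀ := by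
  rw [← T.lintegral_base hΦ (Config.measurable_setLIntegral hf hA)]
  exact lintegral_mono fun ω => lintegral_mono' (Measure.restrict_mono le_rfl (T.toMeasure_le ω))
    le_rfl

theorem setLIntegral_center (hΦ : Measurable Φ) (hfin : intensity P₀ Φ < ∞) {h : Grain d → ℝ≥0}
    (hmeas : Measurable h) (hinv : ∀ (x : Space d) (K : Grain d), h (K.translate x) = h K)
    {B : Set (Space d)} (hB : MeasurableSet B) :
    ∫⁻ ω, ∫⁻ K in {K | K.center ∈ B}, h K ∂(T.Ψ ω).toMeasure ∂T.P =
      hIntensity h T.P T.Ψ * volume B :=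
  HardCore.setLIntegral_center (T.isStationary hΦ) T.measurable_Ψ
    ((T.intensity_le hΦ).trans_lt hfin).ne hmeas hinv hB

theorem hIntensity_le (hΦ : Measurable Φ) (hstat : IsStationary P₀ Φ)
    (hfin : intensity P₀ Φ < ∞) {h : Grain d → ℝ≥0}
    (hmeas : Measurable h) (hinv : ∀ (x : Space d) (K : Grain d), h (K.translate x) = h K) :
    hIntensity h T.P T.Ψ ≤ hIntensity h P₀ Φ := by
  have h1 := T.setLIntegral_center hΦ hfin hmeas hinv (measurableSet_cube 0 1)
  have h2 := HardCore.setLIntegral_center hstat hΦ hfin.ne hmeas hinv (measurableSet_cube 0 1)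
  have hv : volume (cube d 0 1) = 1 := by simp [volume_cube]
  rw [hv, mul_one] at h1 h2
  rw [← h1, ← h2]
  exact T.setLIntegral_le hΦ hmeas.coe_nnreal_ennreal
    (measurableSet_center (measurableSet_cube 0 1))

end HardCoreThinning

end Thinning

/-! ### Random shifts of lattice-covariant modifications -/

section RandomShift

variable {d : ℕ}

/-- The rule `F`, applied relative to the origin `u`. -/
def shiftRule (F : Config d × Config d → Config d) (p : (Config d × Config d) × Space d) :
    Config d :=
  (F (p.1.1.translate (-p.2), p.1.2.translate (-p.2))).translate p.2

variable {F : Config d × Config d → Config d}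

theorem measurable_shiftRule (hF : Measurable F) : Measurable (shiftRule F) := by
  have h1 : Measurable fun p : (Config d × Config d) × Space d => p.1.1.translate (-p.2) :=
    Config.measurable_translate.comp (measurable_snd.neg.prodMk measurable_fst.fst)
  have h2 : Measurable fun p : (Config d × Config d) × Space d => p.1.2.translate (-p.2) :=
    Config.measurable_translate.comp (measurable_snd.neg.prodMk measurable_fst.snd)
  exact Config.measurable_translate.comp (measurable_snd.prodMk (hF.comp (h1.prodMk h2)))

theorem shiftRule_translate (φ ψ : Config d) (u x : Space d) :
    shiftRule F ((φ.translate x, ψ.translate x), u + x) =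
      (shiftRule F ((φ, ψ), u)).translate x := by
  simp only [shiftRule, Config.translate_translate]
  rw [neg_add_rev, neg_add_cancel_comm, add_comm u x]

/-- The shifted rule depends on the origin only modulo the lattice. -/
theorem shiftRule_add {G : AddSubgroup (Space d)}
    (hcov : ∀ g ∈ G, ∀ φ ψ : Config d,
      F (φ.translate g, ψ.translate g) = (F (φ, ψ)).translate g)
    {g : Space d} (hg : g ∈ G) (p : Config d × Config d) (u : Space d) :
    shiftRule F (p, g + u) = shiftRule F (p, u) := by
  have h := hcov (-g) (neg_mem hg) (p.1.translate (-u)) (p.2.translate (-u))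
  simp only [Config.translate_translate] at h
  simp only [shiftRule]
  rw [neg_add, h, Config.translate_translate, add_comm g u, add_neg_cancel_right]

theorem shiftRule_subset {p : (Config d × Config d) × Space d}
    (hsub : ∀ φ ψ : Config d, ψ.grains ⊆ φ.grains → (F (φ, ψ)).grains ⊆ φ.grains)
    (hp : p.1.2.grains ⊆ p.1.1.grains) : (shiftRule F p).grains ⊆ p.1.1.grains := by
  intro K hK
  have := hsub _ _ (image_mono hp) (Config.mem_translate.1 hK)
  simpa [Config.mem_translate] using this

theorem shiftRule_isHardCore {p : (Config d × Config d) × Space d}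
    (hhc : ∀ φ ψ : Config d, ψ.grains ⊆ φ.grains → IsHardCore ψ.grains →
      IsHardCore (F (φ, ψ)).grains)
    (hp : p.1.2.grains ⊆ p.1.1.grains) (hp' : IsHardCore p.1.2.grains) :
    IsHardCore (shiftRule F p).grains :=
  (hhc _ _ (image_mono hp) (hp'.translate _)).translate _

/-- A lattice-covariant modification `F` of thinnings can be made stationary: shift the lattice by
an independent uniform vector `u` of a cell `W`. The `h`-intensity of the resulting thinning is the
mean total `h`-value per unit volume of the particles of `F` with center in the cell `W`. -/
theorem exists_thinning_of_covariant {Ω₀ : Type u} [MeasurableSpace Ω₀] {P₀ : Measure Ω₀}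
    {Φ : Ω₀ → Config d} (hΦ : Measurable Φ) (hfin : intensity P₀ Φ < ∞)
    {h : Grain d → ℝ≥0} (hmeas : Measurable h)
    (hinv : ∀ (x : Space d) (K : Grain d), h (K.translate x) = h K)
    {G : AddSubgroup (Space d)} [Countable G] {W : Set (Space d)} (hW : IsTile G W)
    (hF : Measurable F)
    (hcov : ∀ g ∈ G, ∀ φ ψ : Config d,
      F (φ.translate g, ψ.translate g) = (F (φ, ψ)).translate g)
    (hsub : ∀ φ ψ : Config d, ψ.grains ⊆ φ.grains → (F (φ, ψ)).grains ⊆ φ.grains)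
    (hhc : ∀ φ ψ : Config d, ψ.grains ⊆ φ.grains → IsHardCore ψ.grains →
      IsHardCore (F (φ, ψ)).grains)
    (T : HardCoreThinning P₀ Φ) :
    ∃ T' : HardCoreThinning P₀ Φ, hIntensity h T'.P T'.Ψ * volume W =
      ∫⁻ ω, ∫⁻ K in {K | K.center ∈ W}, h K ∂(F (Φ (T.S ω), T.Ψ ω)).toMeasure ∂T.P := by
  have hΦS := T.measurable_base hΦ
  have hpair : Measurable fun ω => (Φ (T.S ω), T.Ψ ω) := hΦS.prodMk T.measurable_Ψ
  set ν : Measure (Space d) := (volume W)⁻¹ • volume.restrict W with hν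
  have hνP : IsProbabilityMeasure ν := by
    refine ⟨?_⟩
    rw [hν, Measure.smul_apply, Measure.restrict_apply_univ, smul_eq_mul,
      ENNReal.inv_mul_cancel hW.volume_ne_zero hW.volume_ne_top]
  have hint : ∀ {f : T.Ω × Space d → ℝ≥0∞}, Measurable f → ∫⁻ q, f q ∂(T.P.prod ν) =
      (volume W)⁻¹ * ∫⁻ u in W, ∫⁻ ω, f (ω, u) ∂T.P := by
    intro f hf
    rw [lintegral_prod_symm _ hf.aemeasurable, hν, lintegral_smul_measure, smul_eq_mul]
  have hrule : Measurable fun q : T.Ω × Space d => shiftRule F ((Φ (T.S q.1), T.Ψ q.1), q.2) :=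
    (measurable_shiftRule hF).comp ((hpair.comp measurable_fst).prodMk measurable_snd)
  have hΦ1 : Measurable fun q : T.Ω × Space d => Φ (T.S q.1) := hΦS.comp measurable_fst
  let T' : HardCoreThinning P₀ Φ :=
    { Ω := T.Ω × Space d
      P := T.P.prod ν
      S := fun q => T.S q.1
      Ψ := fun q => shiftRule F ((Φ (T.S q.1), T.Ψ q.1), q.2)
      measurePreserving_S := T.measurePreserving_S.comp measurePreserving_fst
      measurable_Ψ := hrule
      subset := fun q => shiftRule_subset hsub (T.subset q.1)
      jointlyStationary := by
        intro x
        have hx := Config.measurable_translate_left x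
        refine Measure.ext_of_lintegral _ fun f hf => ?_
        have hlhs : Measurable fun q : T.Ω × Space d => ((Φ (T.S q.1)).translate x,
            (shiftRule F ((Φ (T.S q.1), T.Ψ q.1), q.2)).translate x) :=
          (hx.comp hΦ1).prodMk (hx.comp hrule)
        refine (lintegral_map hf hlhs).trans (Eq.trans ?_ (lintegral_map hf
          (hΦ1.prodMk hrule)).symm)
        refine (hint (hf.comp hlhs)).trans (Eq.trans ?_ (hint (hf.comp (hΦ1.prodMk hrule))).symm)
        congr 1
        have hk : ∀ u, Measurable fun p : Config d × Config d =>
            f (p.1, shiftRule F (p, u)) := fun u =>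
          hf.comp (measurable_fst.prodMk ((measurable_shiftRule hF).comp
            (measurable_id.prodMk measurable_const)))
        calc ∫⁻ u in W, ∫⁻ ω, f ((Φ (T.S ω)).translate x,
                (shiftRule F ((Φ (T.S ω), T.Ψ ω), u)).translate x) ∂T.P
            = ∫⁻ u in W, ∫⁻ ω, f (Φ (T.S ω), shiftRule F ((Φ (T.S ω), T.Ψ ω), u + x)) ∂T.P := by
              refine lintegral_congr fun u => ?_
              rw [← T.lintegral_translate hΦ x (hk (u + x))]
              simp only [shiftRule_translate]
          _ = ∫⁻ u in W, ∫⁻ ω, f (Φ (T.S ω), shiftRule F ((Φ (T.S ω), T.Ψ ω), u)) ∂T.P :=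
              hW.setLIntegral_add_right
                (k := fun u => ∫⁻ ω, f (Φ (T.S ω), shiftRule F ((Φ (T.S ω), T.Ψ ω), u)) ∂T.P)
                (fun g hg u => by simp only [shiftRule_add hcov hg]) x
      hardCore := by
        have := (Measure.quasiMeasurePreserving_fst (μ := T.P) (ν := ν)).ae T.hardCore
        filter_upwards [this] with q hq
        exact shiftRule_isHardCore hhc (T.subset q.1) hq }
  refine ⟨T', ?_⟩
  have hm : Measurable fun K => (h K : ℝ≥0∞) := hmeas.coe_nnreal_ennreal
  have hval : ∀ (B : Set (Space d)), MeasurableSet B → Measurable fun φ : Config d =>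
      ∫⁻ K in {K | K.center ∈ B}, h K ∂φ.toMeasure :=
    fun B hB => Config.measurable_setLIntegral hm (measurableSet_center hB)
  have hFpair : Measurable fun ω => F (Φ (T.S ω), T.Ψ ω) := hF.comp hpair
  -- The `h`-weighted intensity measure of the centers of `F(Φ, Ψ)`, a lattice-invariant measure.
  set m : Measure (Space d) :=
    ((intensityMeasure T.P fun ω => F (Φ (T.S ω), T.Ψ ω)).withDensity
      fun K => (h K : ℝ≥0∞)).map Grain.center with hmdef
  have hmB : ∀ {B : Set (Space d)}, MeasurableSet B → m B =
      ∫⁻ ω, ∫⁻ K in {K | K.center ∈ B}, h K ∂(F (Φ (T.S ω), T.Ψ ω)).toMeasure ∂T.P := by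
    intro B hB
    rw [hmdef, Measure.map_apply Grain.measurable_center hB,
      withDensity_apply _ (Grain.measurable_center hB)]
    exact setLIntegral_intensityMeasure hFpair hm (measurableSet_center hB)
  have htrans : ∀ (φ : Config d) (x : Space d) (B : Set (Space d)), MeasurableSet B →
      ∫⁻ K in {K | K.center ∈ B}, h K ∂(φ.translate x).toMeasure =
        ∫⁻ K in {K | K.center ∈ (fun y => y + x) ⁻¹' B}, h K ∂φ.toMeasure := by
    intro φ x B hB
    rw [Config.toMeasure_translate, setLIntegral_map (measurableSet_center hB) hm
      (Grain.measurable_translate_left x)]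
    simp only [hinv]
    congr 2
    ext K
    simp [Grain.center_translate, add_comm]
  have hminv : VAddInvariantMeasure G (Space d) m := by
    refine ⟨fun g B hB => ?_⟩
    have hpre : (fun y : Space d => g +ᵥ y) ⁻¹' B = (fun y => y + (g : Space d)) ⁻¹' B := by
      ext y
      simp [AddSubgroup.vadd_def, add_comm]
    rw [hpre, hmB (measurable_add_const (g : Space d) hB), hmB hB]
    refine Eq.trans ?_ (T.lintegral_translate hΦ g ((hval B hB).comp hF))
    simp only [Function.comp_apply, hcov g g.2, htrans _ _ B hB]
  have hT' := T'.setLIntegral_center hΦ hfin hmeas hinv hW.measurableSet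
  rw [← hT', ← hmB hW.measurableSet]
  change ∫⁻ q, ∫⁻ K in {K | K.center ∈ W}, h K
    ∂(shiftRule F ((Φ (T.S q.1), T.Ψ q.1), q.2)).toMeasure ∂(T.P.prod ν) = _
  refine (hint ((hval W hW.measurableSet).comp hrule)).trans ?_
  have hinner : ∀ u, ∫⁻ ω, ∫⁻ K in {K | K.center ∈ W}, h K
      ∂(shiftRule F ((Φ (T.S ω), T.Ψ ω), u)).toMeasure ∂T.P = m W := by
    intro u
    have hWu := measurable_add_const u hW.measurableSet
    simp only [shiftRule, htrans _ _ W hW.measurableSet]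
    refine (T.lintegral_translate hΦ (-u) ((hval _ hWu).comp hF)).trans ?_
    refine (hmB hWu).symm.trans ?_
    exact ((hW.preimage_add u).isAddFundamentalDomain m).measure_eq (hW.isAddFundamentalDomain m)
  simp only [Function.comp_apply, hinner]
  rw [setLIntegral_const, mul_left_comm, ENNReal.inv_mul_cancel hW.volume_ne_zero hW.volume_ne_top,
    mul_one]

end RandomShift

/-! ### Swapping the particles inside the cells of a tiling -/

section Swap

variable {d : ℕ}

/-- The grains that lie in the interior of `W` and have their center of gravity in `W`. -/
def cellGrains (W : Set (Space d)) : Set (Grain d) :=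
  {K | (K : Set (Space d)) ⊆ interior W ∧ K.center ∈ W}

theorem measurableSet_cellGrains {W : Set (Space d)} (hW : MeasurableSet W) :
    MeasurableSet (cellGrains W) :=
  (Grain.measurableSet_subset isOpen_interior).inter (measurableSet_center hW)

/-- A grain belongs to at most one cell, since its center does. -/
theorem cellGrains_translate_unique {G : AddSubgroup (Space d)} {W : Set (Space d)}
    (hW : IsTile G W) {g g' : Space d} (hg : g ∈ G) (hg' : g' ∈ G) {K : Grain d}
    (hK : (K.translate (-g)).center ∈ W) (hK' : (K.translate (-g')).center ∈ W) : g = g' := by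
  rw [Grain.center_translate] at hK hK'
  have : g - g' = 0 := hW.eq_zero_of_mem (sub_mem hg hg') hK (by
    rwa [← add_assoc, sub_add_eq_add_sub, add_neg_cancel, zero_sub])
  exact sub_eq_zero.1 this

theorem disjoint_interior_translate_iff (x : Space d) (K L : Grain d) :
    Disjoint (interior (K.translate x : Set (Space d)))
        (interior (L.translate x : Set (Space d))) ↔
      Disjoint (interior (K : Set (Space d))) (interior (L : Set (Space d))) := by
  rw [Grain.interior_translate, Grain.interior_translate,
    disjoint_image_iff (add_right_injective x)]

theorem disjoint_interior_of_mem_cellGrains {G : AddSubgroup (Space d)} {W : Set (Space d)}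
    (hW : IsTile G W) {g g' : Space d} (hg : g ∈ G) (hg' : g' ∈ G) (hne : g ≠ g')
    {K L : Grain d} (hK : K.translate (-g) ∈ cellGrains W)
    (hL : L.translate (-g') ∈ cellGrains W) :
    Disjoint (interior (K : Set (Space d))) (interior (L : Set (Space d))) := by
  rw [disjoint_left]
  intro x hxK hxL
  have hx : ∀ {M : Grain d} {k : Space d}, M.translate (-k) ∈ cellGrains W →
      x ∈ interior (M : Set (Space d)) → -k + x ∈ W := by
    intro M k hM hxM
    refine interior_subset (hM.1 ?_)
    change -k + x ∈ M.translate (-k)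
    rw [Grain.mem_translate, add_sub_cancel_left]
    exact interior_subset hxM
  have : g - g' = 0 := hW.eq_zero_of_mem (sub_mem hg hg') (hx hK hxK) (by
    rw [← add_assoc, sub_add_eq_add_sub, add_neg_cancel, zero_sub]
    exact hx hL hxL)
  exact hne (sub_eq_zero.1 this)

/-- The particles of `ψ`, where those in `A` are replaced by the particles of `φ` in `A ∩ V`. -/
def swapSet (A V : Set (Grain d)) (p : Config d × Config d) : Set (Grain d) :=
  (p.2.grains \ A) ∪ (p.1.grains ∩ (A ∩ V))

/-- The swap in `A` along `V` preserves the hard-core constraint and increases the total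
`h`-value. -/
def IsImproving (h : Grain d → ℝ≥0) (A V : Set (Grain d)) (p : Config d × Config d) : Prop :=
  IsHardCore (swapSet A V p) ∧
    ∫⁻ K in A, h K ∂p.2.toMeasure < ∫⁻ K in A ∩ V, h K ∂p.1.toMeasure

variable {h : Grain d → ℝ≥0} {A V : Set (Grain d)}

theorem measurableSet_isImproving (hmeas : Measurable h) (hA : MeasurableSet A)
    (hV : MeasurableSet V) : MeasurableSet {p | IsImproving h A V p} := by
  have hm : Measurable fun K => (h K : ℝ≥0∞) := hmeas.coe_nnreal_ennreal
  refine MeasurableSet.inter (measurableSet_isHardCore fun D hD => ?_) (measurableSet_lt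
    ((Config.measurable_setLIntegral hm hA).comp measurable_snd)
    ((Config.measurable_setLIntegral hm (hA.inter hV)).comp measurable_fst))
  have : ∀ p : Config d × Config d, ((swapSet A V p ∩ D).encard : ℝ≥0∞) =
      p.2.toMeasure (D \ A) + p.1.toMeasure (D ∩ (A ∩ V)) := by
    intro p
    rw [Config.toMeasure_apply _ (hD.diff hA), Config.toMeasure_apply _ (hD.inter (hA.inter hV)),
      ← ENat.toENNReal_add, ← encard_union_eq]
    · congr 2
      ext K
      simp only [swapSet, mem_inter_iff, mem_union, Set.mem_sdiff]
      tauto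
    · rw [disjoint_left]
      exact fun K h1 h2 => h1.2.2 h2.2.2.1
  simp_rw [this]
  exact ((Config.measurable_apply (hD.diff hA)).comp measurable_snd).add
    ((Config.measurable_apply (hD.inter (hA.inter hV))).comp measurable_fst)

/-- Translation of a pair of configurations. -/
def translatePair (x : Space d) (p : Config d × Config d) : Config d × Config d :=
  (p.1.translate x, p.2.translate x)

theorem measurable_translatePair (x : Space d) :
    Measurable (translatePair x : Config d × Config d → Config d × Config d) :=
  ((Config.measurable_translate_left x).comp measurable_fst).prodMk
    ((Config.measurable_translate_left x).comp measurable_snd)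

/-- In each cell of the tiling, the swap along `V` (in the coordinates of that cell) is carried out
if it is improving. Particles that belong to no cell are left alone. -/
def cellSwap (h : Grain d → ℝ≥0) (G : AddSubgroup (Space d)) (A V : Set (Grain d))
    (p : Config d × Config d) : Config d where
  grains := {K | (K ∈ p.2.grains ∧
      ∀ g ∈ G, K.translate (-g) ∈ A → ¬ IsImproving h A V (translatePair (-g) p)) ∨
    (K ∈ p.1.grains ∧
      ∃ g ∈ G, K.translate (-g) ∈ A ∩ V ∧ IsImproving h A V (translatePair (-g) p))}
  locallyFinite C hC := by
    refine ((p.2.locallyFinite C hC).union (p.1.locallyFinite C hC)).subset ?_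
    rintro K ⟨⟨hK, -⟩ | ⟨hK, -⟩, hKC⟩
    · exact Or.inl ⟨hK, hKC⟩
    · exact Or.inr ⟨hK, hKC⟩

variable {G : AddSubgroup (Space d)} {W : Set (Space d)}

theorem mem_cellSwap_of_forall_notMem {p : Config d × Config d} {K : Grain d}
    (hK : ∀ g ∈ G, K.translate (-g) ∉ A) :
    K ∈ (cellSwap h G A V p).grains ↔ K ∈ p.2.grains := by
  constructor
  · rintro (⟨h1, -⟩ | ⟨-, g, hg, h2, -⟩)
    · exact h1
    · exact absurd h2.1 (hK g hg)
  · exact fun h1 => Or.inl ⟨h1, fun g hg h2 => absurd h2 (hK g hg)⟩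

theorem mem_cellSwap_of_isImproving (hW : IsTile G W) {p : Config d × Config d} {K : Grain d}
    {g : Space d} (hg : g ∈ G) (hK : K.translate (-g) ∈ cellGrains W)
    (himp : IsImproving h (cellGrains W) V (translatePair (-g) p)) :
    K ∈ (cellSwap h G (cellGrains W) V p).grains ↔ K ∈ p.1.grains ∧ K.translate (-g) ∈ V := by
  constructor
  · rintro (⟨-, h1⟩ | ⟨h1, g', hg', h2, -⟩)
    · exact absurd himp (h1 g hg hK)
    · obtain rfl := cellGrains_translate_unique hW hg hg' hK.2 h2.1.2
      exact ⟨h1, h2.2⟩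
  · exact fun h1 => Or.inr ⟨h1.1, g, hg, ⟨hK, h1.2⟩, himp⟩

theorem mem_cellSwap_of_not_isImproving (hW : IsTile G W) {p : Config d × Config d} {K : Grain d}
    {g : Space d} (hg : g ∈ G) (hK : K.translate (-g) ∈ cellGrains W)
    (himp : ¬ IsImproving h (cellGrains W) V (translatePair (-g) p)) :
    K ∈ (cellSwap h G (cellGrains W) V p).grains ↔ K ∈ p.2.grains := by
  constructor
  · rintro (⟨h1, -⟩ | ⟨-, g', hg', h2, h3⟩)
    · exact h1
    · obtain rfl := cellGrains_translate_unique hW hg hg' hK.2 h2.1.2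
      exact absurd h3 himp
  · refine fun h1 => Or.inl ⟨h1, fun g' hg' h2 => ?_⟩
    obtain rfl := cellGrains_translate_unique hW hg hg' hK.2 h2.2
    exact himp

theorem cellSwap_subset {p : Config d × Config d} (hp : p.2.grains ⊆ p.1.grains) :
    (cellSwap h G A V p).grains ⊆ p.1.grains := by
  rintro K (⟨hK, -⟩ | ⟨hK, -⟩)
  · exact hp hK
  · exact hK

theorem translatePair_translatePair (x y : Space d) (p : Config d × Config d) :
    translatePair x (translatePair y p) = translatePair (x + y) p := by
  simp only [translatePair, Config.translate_translate]

theorem cellSwap_translate (hW : IsTile G W) {g : Space d} (hg : g ∈ G)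
    (p : Config d × Config d) :
    cellSwap h G (cellGrains W) V (translatePair g p) =
      (cellSwap h G (cellGrains W) V p).translate g := by
  ext K
  rw [Config.mem_translate]
  have hshift : ∀ k, translatePair (-k) (translatePair g p) = translatePair (-(k - g)) p := by
    intro k
    rw [translatePair_translatePair, neg_sub, neg_add_eq_sub]
  have hgrain : ∀ k, (K.translate (-g)).translate (-(k - g)) = K.translate (-k) := by
    intro k
    rw [Grain.translate_translate, neg_sub, sub_add_eq_add_sub, add_neg_cancel, zero_sub]
  by_cases hK : ∃ k ∈ G, K.translate (-k) ∈ cellGrains W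
  · obtain ⟨k, hk, hKk⟩ := hK
    have hKk' : (K.translate (-g)).translate (-(k - g)) ∈ cellGrains W := by rwa [hgrain]
    by_cases himp : IsImproving h (cellGrains W) V (translatePair (-(k - g)) p)
    · rw [mem_cellSwap_of_isImproving hW (sub_mem hk hg) hKk' himp,
        mem_cellSwap_of_isImproving hW hk hKk (by rwa [hshift]), hgrain]
      simp only [translatePair, Config.mem_translate]
    · rw [mem_cellSwap_of_not_isImproving hW (sub_mem hk hg) hKk' himp,
        mem_cellSwap_of_not_isImproving hW hk hKk (by rwa [hshift])]
      simp only [translatePair, Config.mem_translate]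
  · push Not at hK
    rw [mem_cellSwap_of_forall_notMem hK, mem_cellSwap_of_forall_notMem]
    · simp only [translatePair, Config.mem_translate]
    · intro k hk
      rw [← add_sub_cancel_right k g, hgrain]
      exact hK _ (add_mem hk hg)

theorem cellSwap_isHardCore (hW : IsTile G W) {p : Config d × Config d}
    (hp : IsHardCore p.2.grains) :
    IsHardCore (cellSwap h G (cellGrains W) V p).grains := by
  have key : ∀ {K L : Grain d}, K ∈ (cellSwap h G (cellGrains W) V p).grains →
      L ∈ (cellSwap h G (cellGrains W) V p).grains → K ≠ L →
      (∃ g ∈ G, K.translate (-g) ∈ cellGrains W) →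
      Disjoint (interior (K : Set (Space d))) (interior (L : Set (Space d))) := by
    rintro K L hK hL hne ⟨g, hg, hKg⟩
    -- Grains in different cells are disjoint, so `L` may be assumed to lie in the cell of `K` or
    -- in no cell.
    by_cases hLg : ∃ g' ∈ G, g ≠ g' ∧ L.translate (-g') ∈ cellGrains W
    · obtain ⟨g', hg', hgg', hL'⟩ := hLg
      exact disjoint_interior_of_mem_cellGrains hW hg hg' hgg' hKg hL'
    by_cases himp : IsImproving h (cellGrains W) V (translatePair (-g) p)
    · rw [← disjoint_interior_translate_iff (-g)]
      refine himp.1 ?_ ?_ ((Grain.translate_injective (-g)).ne hne)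
      · obtain ⟨h1, h2⟩ := (mem_cellSwap_of_isImproving hW hg hKg himp).1 hK
        exact Or.inr ⟨mem_image_of_mem _ h1, hKg, h2⟩
      · by_cases hLA : L.translate (-g) ∈ cellGrains W
        · obtain ⟨h1, h2⟩ := (mem_cellSwap_of_isImproving hW hg hLA himp).1 hL
          exact Or.inr ⟨mem_image_of_mem _ h1, hLA, h2⟩
        · refine Or.inl ⟨mem_image_of_mem _ ((mem_cellSwap_of_forall_notMem ?_).1 hL), hLA⟩
          intro g' hg' hL'
          rcases eq_or_ne g g' with rfl | hgg'
          · exact hLA hL'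
          · exact hLg ⟨g', hg', hgg', hL'⟩
    · refine hp ((mem_cellSwap_of_not_isImproving hW hg hKg himp).1 hK) ?_ hne
      by_cases hLA : L.translate (-g) ∈ cellGrains W
      · exact (mem_cellSwap_of_not_isImproving hW hg hLA himp).1 hL
      · refine (mem_cellSwap_of_forall_notMem ?_).1 hL
        intro g' hg' hL'
        rcases eq_or_ne g g' with rfl | hgg'
        · exact hLA hL'
        · exact hLg ⟨g', hg', hgg', hL'⟩
  intro K hK L hL hne
  by_cases hKA : ∃ g ∈ G, K.translate (-g) ∈ cellGrains W
  · exact key hK hL hne hKA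
  by_cases hLA : ∃ g ∈ G, L.translate (-g) ∈ cellGrains W
  · exact (key hL hK hne.symm hLA).symm
  push Not at hKA hLA
  exact hp ((mem_cellSwap_of_forall_notMem hKA).1 hK) ((mem_cellSwap_of_forall_notMem hLA).1 hL) hne

/-- The number of particles of the modified configuration in a set `D` is the number of particles
of `ψ` in `D` outside all cells, plus a contribution of each cell that is decided by an event. -/
theorem measurable_cellSwap [Countable G] (hW : IsTile G W) (hmeas : Measurable h)
    (hV : MeasurableSet V) : Measurable (cellSwap h G (cellGrains W) V) := by
  classical
  have hA := measurableSet_cellGrains hW.measurableSet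
  rw [Config.measurable_iff]
  intro D hD
  -- The cell `A g` collects the grains whose `g`-th translate back lies in the reference cell.
  let A : G → Set (Grain d) := fun g => Grain.translate (-(g : Space d)) ⁻¹' cellGrains W
  let V' : G → Set (Grain d) := fun g => Grain.translate (-(g : Space d)) ⁻¹' V
  have hAm : ∀ g, MeasurableSet (A g) := fun g => Grain.measurable_translate_left _ hA
  have hVm : ∀ g, MeasurableSet (V' g) := fun g => Grain.measurable_translate_left _ hV
  have hdisj : Pairwise (Function.onFun Disjoint A) := by
    intro g g' hne
    rw [Function.onFun, disjoint_left]
    exact fun K hK hK' => hne (Subtype.ext (cellGrains_translate_unique hW g.2 g'.2 hK.2 hK'.2))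
  have hrest : MeasurableSet (D \ ⋃ g, A g) := hD.diff (MeasurableSet.iUnion hAm)
  have hZ : ∀ g : G, MeasurableSet {p : Config d × Config d |
      IsImproving h (cellGrains W) V (translatePair (-(g : Space d)) p)} := fun g =>
    measurable_translatePair _ (measurableSet_isImproving hmeas hA hV)
  have hsum : ∀ p : Config d × Config d, (cellSwap h G (cellGrains W) V p).toMeasure D =
      p.2.toMeasure (D \ ⋃ g, A g) + ∑' g : G,
        if IsImproving h (cellGrains W) V (translatePair (-(g : Space d)) p) then
          p.1.toMeasure (D ∩ A g ∩ V' g) else p.2.toMeasure (D ∩ A g) := by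
    intro p
    have hsplit : D = (D \ ⋃ g, A g) ∪ ⋃ g, D ∩ A g := by
      rw [← inter_iUnion, sdiff_union_inter]
    conv_lhs => rw [hsplit]
    rw [measure_union ?_ (MeasurableSet.iUnion fun g => hD.inter (hAm g)), measure_iUnion
      (fun g g' hne => (hdisj hne).mono inter_subset_right inter_subset_right)
      fun g => hD.inter (hAm g)]
    · congr 1
      · rw [Config.toMeasure_apply _ hrest, Config.toMeasure_apply _ hrest]
        congr 2
        ext K
        refine and_congr_left fun hK => mem_cellSwap_of_forall_notMem fun g hg hKg => ?_
        exact hK.2 (mem_iUnion.2 ⟨⟨g, hg⟩, hKg⟩)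
      · refine tsum_congr fun g => ?_
        rw [Config.toMeasure_apply _ (hD.inter (hAm g))]
        split_ifs with himp
        · rw [Config.toMeasure_apply _ ((hD.inter (hAm g)).inter (hVm g))]
          congr 2
          ext K
          constructor
          · rintro ⟨h1, h2⟩
            have h3 := (mem_cellSwap_of_isImproving hW g.2 h2.2 himp).1 h1
            exact ⟨h3.1, h2, h3.2⟩
          · rintro ⟨h1, h2, h3⟩
            exact ⟨(mem_cellSwap_of_isImproving hW g.2 h2.2 himp).2 ⟨h1, h3⟩, h2⟩
        · rw [Config.toMeasure_apply _ (hD.inter (hAm g))]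
          congr 2
          ext K
          exact and_congr_left fun h2 => mem_cellSwap_of_not_isImproving hW g.2 h2.2 himp
    · rw [← inter_iUnion]
      exact disjoint_sdiff_left.mono_right inter_subset_right
  simp_rw [hsum]
  refine ((Config.measurable_apply hrest).comp measurable_snd).add
    (Measurable.tsum fun g => Measurable.ite (hZ g) ?_ ?_)
  · exact (Config.measurable_apply ((hD.inter (hAm g)).inter (hVm g))).comp measurable_fst
  · exact (Config.measurable_apply (hD.inter (hAm g))).comp measurable_snd

open Classical in
/-- In the reference cell, the rule changes the total `h`-value by the gain of the swap. -/
theorem setLIntegral_cellSwap (hW : IsTile G W) (hV : MeasurableSet V)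
    (p : Config d × Config d) :
    ∫⁻ K in {K | K.center ∈ W}, h K ∂(cellSwap h G (cellGrains W) V p).toMeasure =
      ∫⁻ K in {K | K.center ∈ W} \ cellGrains W, h K ∂p.2.toMeasure +
        if IsImproving h (cellGrains W) V p then
          ∫⁻ K in cellGrains W ∩ V, h K ∂p.1.toMeasure
        else ∫⁻ K in cellGrains W, h K ∂p.2.toMeasure := by
  have hA := measurableSet_cellGrains hW.measurableSet
  have hC := measurableSet_center (d := d) hW.measurableSet
  have hsub : cellGrains W ⊆ {K | K.center ∈ W} := fun K hK => hK.2
  have hp0 : translatePair (-0) p = p := by simp [translatePair]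
  have hK0 : ∀ K ∈ cellGrains W, K.translate (-0) ∈ cellGrains W := by
    intro K hK
    rwa [neg_zero, Grain.translate_zero]
  rw [← sdiff_union_of_subset hsub, lintegral_union hA disjoint_sdiff_left,
    sdiff_union_of_subset hsub]
  simp only [Config.setLIntegral_toMeasure _ _ hA, Config.setLIntegral_toMeasure _ _ (hC.diff hA),
    Config.setLIntegral_toMeasure _ _ (hA.inter hV)]
  congr 1
  · congr 2
    ext K
    refine and_congr_left fun hK => mem_cellSwap_of_forall_notMem fun g hg hKg => hK.2 ?_
    have h0 := cellGrains_translate_unique hW hg G.zero_mem hKg.2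
      (by rw [neg_zero, Grain.translate_zero]; exact hK.1)
    rwa [h0, neg_zero, Grain.translate_zero] at hKg
  · split_ifs with himp
    · congr 2
      ext K
      constructor
      · rintro ⟨h1, h2⟩
        have h3 := (mem_cellSwap_of_isImproving hW G.zero_mem (hK0 K h2) (by rwa [hp0])).1 h1
        rw [neg_zero, Grain.translate_zero] at h3
        exact ⟨h3.1, h2, h3.2⟩
      · rintro ⟨h1, h2, h3⟩
        refine ⟨(mem_cellSwap_of_isImproving hW G.zero_mem (hK0 K h2) (by rwa [hp0])).2
          ⟨h1, ?_⟩, h2⟩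
        rwa [neg_zero, Grain.translate_zero]
    · congr 2
      ext K
      exact and_congr_left fun h2 =>
        mem_cellSwap_of_not_isImproving hW G.zero_mem (hK0 K h2) (by rwa [hp0])

/-- In an `h`-intensity maximal thinning, almost surely no cell admits an improving swap: otherwise
carrying out all improving swaps in a randomly shifted tiling would increase the `h`-intensity. -/
theorem ae_not_isImproving {Ω₀ : Type u} [MeasurableSpace Ω₀] {P₀ : Measure Ω₀}
    {Φ : Ω₀ → Config d} (hΦ : Measurable Φ) (hstat : IsStationary P₀ Φ)
    (hfin : intensity P₀ Φ < ∞) (hmeas : Measurable h)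
    (hinv : ∀ (x : Space d) (K : Grain d), h (K.translate x) = h K)
    (hhfin : hIntensity h P₀ Φ < ∞) [Countable G] (hW : IsTile G W) (hV : MeasurableSet V)
    {T : HardCoreThinning P₀ Φ} (hT : T ∈ intensityMaximal h P₀ Φ) :
    ∀ᵐ ω ∂T.P, ¬ IsImproving h (cellGrains W) V (Φ (T.S ω), T.Ψ ω) := by
  classical
  have hm : Measurable fun K => (h K : ℝ≥0∞) := hmeas.coe_nnreal_ennreal
  have hA := measurableSet_cellGrains hW.measurableSet
  have hC := measurableSet_center (d := d) hW.measurableSet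
  have hsub : cellGrains W ⊆ {K | K.center ∈ W} := fun K hK => hK.2
  have hF := measurable_cellSwap hW hmeas hV
  obtain ⟨T', hT'⟩ := exists_thinning_of_covariant hΦ hfin hmeas hinv hW hF
    (fun g hg φ ψ => cellSwap_translate hW hg (φ, ψ)) (fun φ ψ hp => cellSwap_subset hp)
    (fun φ ψ _ hp' => cellSwap_isHardCore hW hp') T
  have hle : hIntensity h T'.P T'.Ψ ≤ hIntensity h T.P T.Ψ :=
    (le_iSup (fun T : HardCoreThinning P₀ Φ => hIntensity h T.P T.Ψ) T').trans hT.ge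
  have hTval := T.setLIntegral_center hΦ hfin hmeas hinv hW.measurableSet
  have hpair : Measurable fun ω => (Φ (T.S ω), T.Ψ ω) :=
    (T.measurable_base hΦ).prodMk T.measurable_Ψ
  have hψ : ∀ ω, ∫⁻ K in {K | K.center ∈ W}, h K ∂(T.Ψ ω).toMeasure =
      ∫⁻ K in {K | K.center ∈ W} \ cellGrains W, h K ∂(T.Ψ ω).toMeasure +
        ∫⁻ K in cellGrains W, h K ∂(T.Ψ ω).toMeasure := by
    intro ω
    rw [← lintegral_union hA disjoint_sdiff_left, sdiff_union_of_subset hsub]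
  have hfinite : ∫⁻ ω, ∫⁻ K in {K | K.center ∈ W}, h K ∂(T.Ψ ω).toMeasure ∂T.P ≠ ∞ := by
    rw [hTval]
    exact ENNReal.mul_ne_top ((T.hIntensity_le hΦ hstat hfin hmeas hinv).trans_lt hhfin).ne
      hW.volume_ne_top
  have hmono : ∀ ω, ∫⁻ K in {K | K.center ∈ W}, h K ∂(T.Ψ ω).toMeasure ≤
      ∫⁻ K in {K | K.center ∈ W}, h K
        ∂(cellSwap h G (cellGrains W) V (Φ (T.S ω), T.Ψ ω)).toMeasure := by
    intro ω
    rw [setLIntegral_cellSwap hW hV, hψ]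
    split_ifs with himp
    · exact add_le_add_right himp.2.le _
    · exact le_rfl
  have hae := ae_eq_of_ae_le_of_lintegral_le (Eventually.of_forall hmono) hfinite
    (((Config.measurable_setLIntegral hm hC).comp (hF.comp hpair)).aemeasurable)
    (by rw [hTval, ← hT']; exact mul_le_mul_left hle _)
  have hlt := ae_lt_top ((Config.measurable_setLIntegral hm hC).comp T.measurable_Ψ) hfinite
  filter_upwards [hae, hlt] with ω h1 h2 himp
  rw [setLIntegral_cellSwap hW hV, if_pos himp, hψ] at h1
  rw [Function.comp_apply, hψ] at h2
  have h3 := (ENNReal.add_lt_top.1 h2).1.ne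
  exact himp.2.ne ((ENNReal.add_right_inj h3).1 h1)

end Swap

/-! ### Selecting finite sets of particles by countably many Borel sets -/

section Selection

variable {d : ℕ}

/-- The finite unions of members of a countable basis of the topology on the space of grains. -/
def basicUnion (I : Finset (TopologicalSpace.countableBasis (Grain d))) : Set (Grain d) :=
  ⋃ U ∈ I, (U : Set (Grain d))

theorem measurableSet_basicUnion (I : Finset (TopologicalSpace.countableBasis (Grain d))) :
    MeasurableSet (basicUnion I) :=
  (isOpen_biUnion fun U _ => TopologicalSpace.isOpen_of_mem_countableBasis U.2).measurableSet

/-- Every subset of a finite set of grains is cut out by a finite union of basic open sets. -/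
theorem exists_inter_basicUnion_eq {s t : Set (Grain d)} (hs : s.Finite) (hts : t ⊆ s) :
    ∃ I : Finset (TopologicalSpace.countableBasis (Grain d)), s ∩ basicUnion I = t := by
  classical
  have hU : ∀ K : t, ∃ U : TopologicalSpace.countableBasis (Grain d),
      (K : Grain d) ∈ (U : Set (Grain d)) ∧ (U : Set (Grain d)) ⊆ (s \ t)ᶜ := by
    rintro ⟨K, hK⟩
    obtain ⟨U, hUb, hKU, hUs⟩ :=
      (TopologicalSpace.isBasis_countableBasis (Grain d)).exists_subset_of_mem_open
        (show K ∈ (s \ t)ᶜ from fun h => h.2 hK)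
        (hs.subset sdiff_subset).isClosed.isOpen_compl
    exact ⟨⟨U, hUb⟩, hKU, hUs⟩
  choose U hU using hU
  have := (hs.subset hts).to_subtype
  refine ⟨(finite_range U).toFinset, ?_⟩
  ext K
  simp only [basicUnion, mem_inter_iff, mem_iUnion, Finite.mem_toFinset, mem_range, exists_prop]
  constructor
  · rintro ⟨hK, _, ⟨L, rfl⟩, hKL⟩
    by_contra hKt
    exact (hU L).2 hKL ⟨hK, hKt⟩
  · exact fun hK => ⟨hts hK, U ⟨K, hK⟩, ⟨⟨K, hK⟩, rfl⟩, (hU ⟨K, hK⟩).1⟩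

end Selection

/-! ### Values of finite sets of particles -/

section Value

variable {d : ℕ} (h : Grain d → ℝ≥0)

theorem setLIntegral_count_eq_finsum {s : Set (Grain d)} (hs : s.Finite) :
    ∫⁻ K in s, h K ∂Measure.count = ((∑ᶠ K ∈ s, h K : ℝ≥0) : ℝ≥0∞) := by
  lift s to Finset (Grain d) using hs
  rw [lintegral_finset, finsum_mem_coe_finset, ENNReal.ofNNReal_finsetSum]
  simp

/-- If `s` exceeds `t` only inside `B`, then the value of `s` in `B` is the value of the common
part in `B` plus that of `s \ t`. -/
theorem setLIntegral_count_split {s t B : Set (Grain d)} (hs : s.Countable)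
    (hB : s \ t ⊆ B) :
    ∫⁻ K in s ∩ B, h K ∂Measure.count =
      ∫⁻ K in s ∩ t ∩ B, h K ∂Measure.count + ∫⁻ K in s \ t, h K ∂Measure.count := by
  have : s ∩ B = s ∩ t ∩ B ∪ s \ t := by
    ext K
    have := @hB K
    simp only [Set.mem_sdiff, mem_inter_iff, mem_union] at this ⊢
    tauto
  rw [this, lintegral_union (hs.mono sdiff_subset).measurableSet]
  exact disjoint_left.2 fun K h1 h2 => h2.2 h1.1.2

end Value

/-! ### Intensity maximal thinnings are locally maximal -/

section LocallyMaximal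

variable {d : ℕ} {h : Grain d → ℝ≥0}

theorem finite_inter_of_subset {φ : Config d} {C : Set (Space d)} (hC : IsCompact C)
    {A : Set (Grain d)} (hA : ∀ K ∈ A, (K : Set (Space d)) ⊆ C) : (φ.grains ∩ A).Finite :=
  (φ.locallyFinite C hC).subset fun K hK =>
    ⟨hK.1, K.nonempty.mono (subset_inter Subset.rfl (hA K hK.2))⟩

theorem exists_ball_superset {s : Set (Grain d)} (hs : s.Finite) :
    ∃ R : ℕ, ∀ K ∈ s, (K : Set (Space d)) ⊆ Metric.ball 0 (R + 1) ∧
      K.center ∈ Metric.ball (0 : Space d) (R + 1) := by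
  have hb : Bornology.IsBounded (⋃ K ∈ s, ((K : Set (Space d)) ∪ {K.center})) :=
    (Bornology.isBounded_biUnion hs).2 fun K _ =>
      K.isCompact.isBounded.union Bornology.isBounded_singleton
  obtain ⟨r, hr⟩ := hb.subset_ball 0
  obtain ⟨R, hR⟩ := exists_nat_ge r
  have hsub : Metric.ball (0 : Space d) r ⊆ Metric.ball 0 (R + 1) :=
    Metric.ball_subset_ball (by linarith)
  refine ⟨R, fun K hK => ⟨fun x hx => hsub (hr ?_), hsub (hr ?_)⟩⟩
  · exact mem_biUnion hK (Or.inl hx)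
  · exact mem_biUnion hK (Or.inr rfl)

/-- Every finite improvement of a thinning is an improving swap in a sufficiently large cell along
a finite union of basic open sets. Hence the absence of such swaps means local maximality. -/
theorem isLocallyMaximal_of_forall_not_isImproving {φ ψ : Config d} (hsub : ψ.grains ⊆ φ.grains)
    (hψ : IsHardCore ψ.grains) {W : ℕ → Set (Space d)}
    (hWm : ∀ n, MeasurableSet (W n))
    (hWb : ∀ n, Bornology.IsBounded (W n))
    (hW : ∀ n : ℕ, Metric.ball 0 ((n : ℝ) + 1) ⊆ W n)
    (hno : ∀ n I, ¬ IsImproving h (cellGrains (W n)) (basicUnion I) (φ, ψ)) :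
    IsLocallyMaximal h φ.grains ψ.grains := by
  refine ⟨hsub, hψ, fun ψ' hψ'φ hψ' hfin => ?_⟩
  by_contra hlt
  rw [not_le] at hlt
  obtain ⟨R, hR⟩ := exists_ball_superset hfin
  set A := cellGrains (W R) with hAdef
  have hA : MeasurableSet A := measurableSet_cellGrains (hWm R)
  have hsymm : symmDiff ψ.grains ψ' ⊆ A := fun K hK =>
    ⟨(hR K hK).1.trans (interior_maximal (hW R) Metric.isOpen_ball), hW R (hR K hK).2⟩
  have h1 : ψ.grains \ ψ' ⊆ A := subset_union_left.trans hsymm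
  have h2 : ψ' \ ψ.grains ⊆ A := subset_union_right.trans hsymm
  have hφA : (φ.grains ∩ A).Finite := finite_inter_of_subset (hWb R).isCompact_closure
    fun K hK => hK.1.trans (interior_subset.trans subset_closure)
  obtain ⟨I, hI⟩ := exists_inter_basicUnion_eq hφA (t := ψ' ∩ A)
    (inter_subset_inter_left _ hψ'φ)
  rw [inter_assoc] at hI
  refine hno R I ⟨?_, ?_⟩
  · have : swapSet A (basicUnion I) (φ, ψ) = ψ' := by
      ext K
      have h1' := @h1 K
      have h2' := @h2 K
      simp only [swapSet, hI, mem_union, Set.mem_sdiff, mem_inter_iff] at h1' h2' ⊢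
      tauto
    rwa [this]
  · have hψ'c : ψ'.Countable := φ.countable_grains.mono hψ'φ
    rw [Config.setLIntegral_toMeasure _ _ hA,
      Config.setLIntegral_toMeasure _ _ (hA.inter (measurableSet_basicUnion I)), hI,
      setLIntegral_count_split h ψ.countable_grains h1, setLIntegral_count_split h hψ'c h2,
      setLIntegral_count_eq_finsum h (hfin.subset subset_union_left),
      setLIntegral_count_eq_finsum h (hfin.subset subset_union_right), inter_comm ψ' ψ.grains]
    refine ENNReal.add_lt_add_left ?_ (ENNReal.coe_lt_coe.2 hlt)
    rw [setLIntegral_count_eq_finsum h (hφA.subset fun K hK => ⟨hsub hK.1.1, hK.2⟩)]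
    exact ENNReal.coe_ne_top

theorem intensityMaximal_subset_locallyMaximal {Ω₀ : Type u} [MeasurableSpace Ω₀]
    {P₀ : Measure Ω₀} {Φ : Ω₀ → Config d} (hΦ : Measurable Φ) (hstat : IsStationary P₀ Φ)
    (hfin : intensity P₀ Φ < ∞) (hmeas : Measurable h)
    (hinv : ∀ (x : Space d) (K : Grain d), h (K.translate x) = h K)
    (hhfin : hIntensity h P₀ Φ < ∞) :
    intensityMaximal h P₀ Φ ⊆ locallyMaximal h P₀ Φ := by
  intro T hT
  choose G W hG hW hWb hball using fun n : ℕ => exists_isTile d (Nat.cast_add_one_pos (α := ℝ) n)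
  have hno : ∀ᵐ ω ∂T.P, ∀ n I,
      ¬ IsImproving h (cellGrains (W n)) (basicUnion I) (Φ (T.S ω), T.Ψ ω) := by
    rw [ae_all_iff]
    intro n
    rw [ae_all_iff]
    intro I
    have := hG n
    exact ae_not_isImproving hΦ hstat hfin hmeas hinv hhfin (hW n)
      (measurableSet_basicUnion I) hT
  filter_upwards [hno, T.hardCore] with ω hω hhc
  exact isLocallyMaximal_of_forall_not_isImproving (T.subset ω) hhc
    (fun n => (hW n).measurableSet) hWb hball hω

end LocallyMaximal

/-! ### Optimal packings in a cube -/

section BestValue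

variable {d : ℕ} {h : Grain d → ℝ≥0}

/-- The grains contained in the cube `[0, r]^d`. -/
def insideGrains (d : ℕ) (r : ℝ) : Set (Grain d) :=
  {K | (K : Set (Space d)) ⊆ cube d 0 r}

/-- The grains that meet the cube `[0, r]^d`. -/
def hittingGrains (d : ℕ) (r : ℝ) : Set (Grain d) :=
  {K | ((K : Set (Space d)) ∩ cube d 0 r).Nonempty}

theorem measurableSet_insideGrains (r : ℝ) : MeasurableSet (insideGrains d r) :=
  Grain.measurableSet_subset_of_isClosed (isClosed_cube 0 r)

theorem measurableSet_hittingGrains (r : ℝ) : MeasurableSet (hittingGrains d r) :=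
  Grain.measurableSet_hit (isClosed_cube 0 r)

theorem insideGrains_subset_hittingGrains (r : ℝ) : insideGrains d r ⊆ hittingGrains d r :=
  fun K hK => K.nonempty.mono (subset_inter Subset.rfl hK)

open Classical in
/-- The largest total `h`-value of a hard-core family of particles of `φ` inside `[0, r]^d`. The
supremum runs over a countable family of selections, which reaches all finite sets of particles,
so that this is a measurable function of `φ`. -/
noncomputable def bestValue (h : Grain d → ℝ≥0) (r : ℝ) (φ : Config d) : ℝ≥0∞ :=
  ⨆ I : Finset (TopologicalSpace.countableBasis (Grain d)),
    if IsHardCore (φ.grains ∩ (insideGrains d r ∩ basicUnion I)) then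
      ∫⁻ K in insideGrains d r ∩ basicUnion I, h K ∂φ.toMeasure else 0

theorem measurable_bestValue (hmeas : Measurable h) (r : ℝ) :
    Measurable (bestValue h r : Config d → ℝ≥0∞) := by
  classical
  refine Measurable.iSup fun I => ?_
  have hB := (measurableSet_insideGrains (d := d) r).inter (measurableSet_basicUnion I)
  refine Measurable.ite (measurableSet_isHardCore fun D hD => ?_)
    (Config.measurable_setLIntegral hmeas.coe_nnreal_ennreal hB) measurable_const
  have : ∀ φ : Config d, ((φ.grains ∩ (insideGrains d r ∩ basicUnion I) ∩ D).encard : ℝ≥0∞) =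
      φ.toMeasure (insideGrains d r ∩ basicUnion I ∩ D) := fun φ => by
    rw [Config.toMeasure_apply _ (hB.inter hD), inter_assoc φ.grains]
  simp_rw [this]
  exact Config.measurable_apply (hB.inter hD)

theorem le_bestValue {φ ψ : Config d} (hsub : ψ.grains ⊆ φ.grains) (hψ : IsHardCore ψ.grains)
    (r : ℝ) : ∫⁻ K in insideGrains d r, h K ∂ψ.toMeasure ≤ bestValue h r φ := by
  classical
  have hin := measurableSet_insideGrains (d := d) r
  obtain ⟨I, hI⟩ := exists_inter_basicUnion_eq
    (finite_inter_of_subset (φ := φ) (A := insideGrains d r) (isCompact_cube 0 r) fun K hK => hK)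
    (inter_subset_inter_left _ hsub)
  rw [inter_assoc] at hI
  refine le_trans ?_ (le_iSup _ I)
  rw [hI, if_pos (show IsHardCore _ from hψ.mono inter_subset_left),
    Config.setLIntegral_toMeasure _ _ (hin.inter (measurableSet_basicUnion I)), hI,
    Config.setLIntegral_toMeasure _ _ hin]

/-- A locally maximal thinning cannot be improved by removing the particles that meet a cube and
filling the cube in the best possible way. -/
theorem bestValue_le {φ ψ : Config d} (hψ : IsLocallyMaximal h φ.grains ψ.grains) (r : ℝ) :
    bestValue h r φ ≤ ∫⁻ K in hittingGrains d r, h K ∂ψ.toMeasure := by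
  classical
  refine iSup_le fun I => ?_
  split_ifs with hI
  swap
  · exact zero_le
  obtain ⟨hsub, hψhc, hmax⟩ := hψ
  have hin := measurableSet_insideGrains (d := d) r
  have hhit := measurableSet_hittingGrains (d := d) r
  have hih := insideGrains_subset_hittingGrains (d := d) r
  set N : Set (Grain d) := φ.grains ∩ (insideGrains d r ∩ basicUnion I) with hN
  have hNhit : N ⊆ hittingGrains d r := fun K hK => hih hK.2.1
  set ψ' : Set (Grain d) := (ψ.grains \ hittingGrains d r) ∪ N with hψ'
  have hψ'sub : ψ' ⊆ φ.grains := union_subset (sdiff_subset.trans hsub) inter_subset_left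
  have hcross : ∀ {K L : Grain d}, K ∉ hittingGrains d r → L ∈ insideGrains d r →
      Disjoint (interior (K : Set (Space d))) (interior (L : Set (Space d))) := by
    intro K L hK hL
    exact disjoint_left.2 fun x hxK hxL =>
      hK ⟨x, interior_subset hxK, hL (interior_subset hxL)⟩
  have hψ'hc : IsHardCore ψ' := by
    rintro K (hK | hK) L (hL | hL) hne
    · exact hψhc hK.1 hL.1 hne
    · exact hcross hK.2 hL.2.1
    · exact (hcross hL.2 hK.2.1).symm
    · exact hI hK hL hne
  have hfinhit : (φ.grains ∩ hittingGrains d r).Finite := φ.locallyFinite _ (isCompact_cube 0 r)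
  have h1 : ψ.grains \ ψ' ⊆ hittingGrains d r := by
    intro K hK
    by_contra hKh
    exact hK.2 (Or.inl ⟨hK.1, hKh⟩)
  have h2 : ψ' \ ψ.grains ⊆ hittingGrains d r := by
    rintro K ⟨hK | hK, hKψ⟩
    · exact absurd hK.1 hKψ
    · exact hNhit hK
  have hf1 : (ψ.grains \ ψ').Finite := hfinhit.subset fun K hK => ⟨hsub hK.1, h1 hK⟩
  have hf2 : (ψ' \ ψ.grains).Finite := hfinhit.subset fun K hK => ⟨hψ'sub hK.1, h2 hK⟩
  have hψ'hit : ψ' ∩ hittingGrains d r = N := by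
    rw [hψ', union_inter_distrib_right, inter_eq_left.2 hNhit, sdiff_inter_self, empty_union]
  rw [Config.setLIntegral_toMeasure _ _ (hin.inter (measurableSet_basicUnion I)), ← hN, ← hψ'hit,
    Config.setLIntegral_toMeasure _ _ hhit,
    setLIntegral_count_split h (φ.countable_grains.mono hψ'sub) h2,
    setLIntegral_count_split h ψ.countable_grains h1, inter_comm ψ' ψ.grains,
    setLIntegral_count_eq_finsum h hf1, setLIntegral_count_eq_finsum h hf2]
  exact add_le_add_right (ENNReal.coe_le_coe.2 (hmax ψ' hψ'sub hψ'hc (hf1.union hf2))) _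

end BestValue

/-! ### Boundary effects -/

section Boundary

variable {d : ℕ}

/-- The grains whose center lies in `[0, r]^d` although they are not contained in this cube, and
those that meet the cube although their center lies outside. -/
def boundaryGrains (d : ℕ) (r : ℝ) : Set (Grain d) :=
  ({K | K.center ∈ cube d 0 r} \ insideGrains d r) ∪
    (hittingGrains d r \ {K | K.center ∈ cube d 0 r})

theorem measurableSet_boundaryGrains (r : ℝ) : MeasurableSet (boundaryGrains d r) :=
  ((measurableSet_center (measurableSet_cube 0 r)).diff (measurableSet_insideGrains r)).union
    ((measurableSet_hittingGrains r).diff (measurableSet_center (measurableSet_cube 0 r)))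

/-- The set of shifts that move `K` to a boundary grain of the cube `[0, r]^d`. -/
def boundaryShifts (K : Grain d) (r : ℝ) : Set (Space d) :=
  {x | K.translate x ∈ boundaryGrains d r}

theorem measurable_volume_boundaryShifts (r : ℝ) :
    Measurable fun K : Grain d => volume (boundaryShifts K r) := by
  have h1 : Measurable fun p : Grain d × Space d => p.1.translate p.2 :=
    Grain.measurable_translate.comp measurable_swap
  exact measurable_measure_prodMk_left (ν := (volume : Measure (Space d)))
    (h1 (measurableSet_boundaryGrains r))

/-- A cube of side length `n` is covered by `n ^ d` translates of `[-1, 1]^d`, which bounds the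
volume of the set of shifts for which a grain meets the cube. -/
theorem volume_hitting_shifts_le (K : Grain d) {n : ℕ} (hn : 0 < n) :
    volume {x : Space d | K.translate x ∈ hittingGrains d n} ≤
      (n : ℝ≥0∞) ^ d * volume ((K : Set (Space d)) + cube d (-1) 1) := by
  let z : (Fin d → Fin n) → Space d := fun k => WithLp.toLp 2 fun i => ((k i : ℕ) : ℝ)
  have hsub : {x : Space d | K.translate x ∈ hittingGrains d n} ⊆
      ⋃ k : Fin d → Fin n, (fun x => z k - x) ⁻¹' ((K : Set (Space d)) + cube d (-1) 1) := by
    rintro x ⟨w, hwK, hw⟩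
    have hwx : w - x ∈ K := Grain.mem_translate.1 hwK
    have hk : ∀ i, ∃ k : Fin n, ((k : ℕ) : ℝ) - w i ∈ Icc (-1 : ℝ) 1 := by
      intro i
      obtain ⟨h0, h1⟩ := hw i
      -- Rounding up minus one stays below `n`; the coordinate `0` is treated separately.
      rcases h0.eq_or_lt with h0 | h0
      · exact ⟨⟨0, hn⟩, by simp [← h0]⟩
      · have hc : ⌈w i⌉₊ ≤ n := Nat.ceil_le.2 h1
        have hc0 : 0 < ⌈w i⌉₊ := Nat.ceil_pos.2 h0
        refine ⟨⟨⌈w i⌉₊ - 1, by omega⟩, ?_⟩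
        have h2 := Nat.le_ceil (w i)
        have h3 := Nat.ceil_lt_add_one h0.le
        rw [Nat.cast_sub hc0, Nat.cast_one]
        constructor <;> linarith
    choose k hk using hk
    refine mem_iUnion.2 ⟨k, w - x, hwx, z k - w, fun i => hk i, ?_⟩
    simp only
    abel
  have hm : MeasurableSet ((K : Set (Space d)) + cube d (-1) 1) :=
    (K.isCompact.add (isCompact_cube _ _)).measurableSet
  calc volume {x : Space d | K.translate x ∈ hittingGrains d n}
      ≤ ∑ k : Fin d → Fin n,
          volume ((fun x => z k - x) ⁻¹' ((K : Set (Space d)) + cube d (-1) 1)) :=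
        (measure_mono hsub).trans (measure_iUnion_fintype_le _ _)
    _ = ∑ k : Fin d → Fin n, volume ((K : Set (Space d)) + cube d (-1) 1) := by
        refine Finset.sum_congr rfl fun k _ => ?_
        exact (Measure.measurePreserving_sub_left volume (z k)).measure_preimage
          hm.nullMeasurableSet
    _ = (n : ℝ≥0∞) ^ d * volume ((K : Set (Space d)) + cube d (-1) 1) := by
        simp

theorem volume_center_shifts (K : Grain d) (r : ℝ) :
    volume {x : Space d | (K.translate x).center ∈ cube d 0 r} = volume (cube d 0 r) := by
  simp only [Grain.center_translate]
  exact measure_preimage_add_right volume K.center (cube d 0 r)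

theorem volume_cube_natCast (n : ℕ) : volume (cube d 0 n) = (n : ℝ≥0∞) ^ d := by
  rw [volume_cube, sub_zero, ENNReal.ofReal_natCast]

theorem volume_boundaryShifts_le (K : Grain d) {n : ℕ} (hn : 0 < n) :
    volume (boundaryShifts K n) ≤
      (n : ℝ≥0∞) ^ d * (1 + volume ((K : Set (Space d)) + cube d (-1) 1)) := by
  have hsub : boundaryShifts K n ⊆ {x : Space d | (K.translate x).center ∈ cube d 0 n} ∪
      {x : Space d | K.translate x ∈ hittingGrains d n} := by
    rintro x (hx | hx)
    · exact Or.inl hx.1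
    · exact Or.inr hx.1
  refine (measure_mono hsub).trans ((measure_union_le _ _).trans ?_)
  rw [volume_center_shifts, volume_cube_natCast, mul_add, mul_one]
  exact add_le_add_right (volume_hitting_shifts_le K hn) _

/-- If `K` and its center lie in the ball of radius `R`, then only shifts within distance `R` of the
boundary of the cube can produce a boundary grain. -/
theorem boundaryShifts_subset {K : Grain d} {R : ℝ} (hK : (K : Set (Space d)) ⊆ Metric.ball 0 R)
    (hc : K.center ∈ Metric.ball (0 : Space d) R) (r : ℝ) :
    boundaryShifts K r ⊆ cube d (-R) (r + R) \ cube d R (r - R) := by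
  have hcoord : ∀ {y : Space d}, y ∈ Metric.ball (0 : Space d) R → ∀ i, |y i| < R := by
    intro y hy i
    rw [← Real.norm_eq_abs]
    exact (PiLp.norm_apply_le y i).trans_lt (by simpa using hy)
  have hout : ∀ {x y : Space d}, y ∈ Metric.ball (0 : Space d) R → x + y ∈ cube d 0 r →
      x ∈ cube d (-R) (r + R) := by
    intro x y hy hxy i
    have h1 := abs_lt.1 (hcoord hy i)
    have h2 : x i + y i ∈ Icc 0 r := hxy i
    constructor <;> linarith [h2.1, h2.2]
  have hin : ∀ {x y : Space d}, y ∈ Metric.ball (0 : Space d) R → x ∈ cube d R (r - R) →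
      x + y ∈ cube d 0 r := by
    intro x y hy hx i
    have h1 := abs_lt.1 (hcoord hy i)
    have h2 := hx i
    change x i + y i ∈ Icc 0 r
    constructor <;> linarith [h2.1, h2.2]
  rintro x (⟨hx1, hx2⟩ | ⟨⟨w, hwK, hw⟩, hx2⟩)
  · rw [mem_ofPred_eq, Grain.center_translate] at hx1
    refine ⟨hout hc hx1, fun hx => hx2 ?_⟩
    rintro _ ⟨y, hy, rfl⟩
    exact hin (hK hy) hx
  · obtain ⟨y, hy, rfl⟩ := hwK
    refine ⟨hout (hK hy) hw, fun hx => hx2 ?_⟩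
    rw [mem_ofPred_eq, Grain.center_translate]
    exact hin hc hx

theorem tendsto_volume_boundaryShifts (K : Grain d) :
    Tendsto (fun m : ℕ => volume (boundaryShifts K (m + 1 : ℕ)) / ((m + 1 : ℕ) : ℝ≥0∞) ^ d) atTop
      (𝓝 0) := by
  obtain ⟨R', hR'⟩ := exists_ball_superset (finite_singleton K)
  obtain ⟨hK, hc⟩ := hR' K rfl
  set R : ℝ := R' + 1 with hR
  have hR0 : 0 < R := by positivity
  have hreal : Tendsto (fun m : ℕ => (1 + 2 * R / ((m : ℝ) + 1)) ^ d -
      (1 - 2 * R / ((m : ℝ) + 1)) ^ d) atTop (𝓝 0) := by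
    have h0 : Tendsto (fun m : ℕ => 2 * R / ((m : ℝ) + 1)) atTop (𝓝 0) := by
      have := (tendsto_one_div_add_atTop_nhds_zero_nat (𝕜 := ℝ)).const_mul (2 * R)
      simpa [div_eq_mul_inv] using this
    have := ((h0.const_add 1).pow d).sub ((h0.const_sub 1).pow d)
    simpa using this
  have hE := (ENNReal.continuous_ofReal.tendsto 0).comp hreal
  rw [ENNReal.ofReal_zero] at hE
  refine tendsto_of_tendsto_of_tendsto_of_le_of_le' tendsto_const_nhds hE
    (Eventually.of_forall fun _ => zero_le) ?_
  obtain ⟨m₀, hm₀⟩ := exists_nat_ge (2 * R)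
  filter_upwards [eventually_ge_atTop m₀] with m hm
  have hmR : 2 * R ≤ (m : ℝ) + 1 := by
    have : (m₀ : ℝ) ≤ m := by exact_mod_cast hm
    linarith
  have hn0 : (0 : ℝ) < (m : ℝ) + 1 := by positivity
  have hsub : cube d R ((m + 1 : ℕ) - R) ⊆ cube d (-R) ((m + 1 : ℕ) + R) := fun x hx i =>
    ⟨by linarith [(hx i).1], by linarith [(hx i).2]⟩
  have hvol : volume (boundaryShifts K (m + 1 : ℕ)) ≤
      ENNReal.ofReal (((m : ℝ) + 1 + 2 * R) ^ d - ((m : ℝ) + 1 - 2 * R) ^ d) := by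
    refine (measure_mono (boundaryShifts_subset hK hc _)).trans_eq ?_
    rw [measure_sdiff hsub (measurableSet_cube _ _).nullMeasurableSet
      (isCompact_cube _ _).measure_lt_top.ne, volume_cube, volume_cube,
      ENNReal.ofReal_sub _ (pow_nonneg (by linarith) d), ENNReal.ofReal_pow (by linarith),
      ENNReal.ofReal_pow (by linarith)]
    push_cast
    ring_nf
  have hpow : (((m + 1 : ℕ) : ℝ≥0∞)) ^ d = ENNReal.ofReal (((m : ℝ) + 1) ^ d) := by
    rw [ENNReal.ofReal_pow hn0.le, ← Nat.cast_add_one, ENNReal.ofReal_natCast]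
  rw [hpow]
  refine (ENNReal.div_le_div_right hvol _).trans_eq ?_
  rw [← ENNReal.ofReal_div_of_pos (by positivity), Function.comp_apply, sub_div, ← div_pow,
    ← div_pow, add_div, sub_div, div_self hn0.ne']

end Boundary

/-! ### Locally maximal thinnings are intensity maximal -/

section IntensityMaximal

variable {d : ℕ} {h : Grain d → ℝ≥0} {Ω₀ : Type u} [MeasurableSpace Ω₀]
  {P₀ : Measure Ω₀} {Φ : Ω₀ → Config d}

/-- Under the moment condition on the grain size, boundary grains of a large cube carry a
negligible part of the total `h`-value. -/
theorem tendsto_boundary_value (hΦ : Measurable Φ) (hstat : IsStationary P₀ Φ)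
    (hfin : intensity P₀ Φ < ∞) (hmeas : Measurable h)
    (hinv : ∀ (x : Space d) (K : Grain d), h (K.translate x) = h K)
    (hhfin : hIntensity h P₀ Φ < ∞)
    (hsize : ∫⁻ K, volume ((K : Set (Space d)) + cube d (-1) 1) * (h K : ℝ≥0∞)
      ∂(typicalGrain P₀ Φ) < ∞) :
    Tendsto (fun m : ℕ => (∫⁻ K in boundaryGrains d (m + 1 : ℕ), h K ∂intensityMeasure P₀ Φ) /
      ((m + 1 : ℕ) : ℝ≥0∞) ^ d) atTop (𝓝 0) := by
  have hm : Measurable fun K => (h K : ℝ≥0∞) := hmeas.coe_nnreal_ennreal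
  have hcampbell : ∀ r : ℝ, ∫⁻ K in boundaryGrains d r, h K ∂intensityMeasure P₀ Φ =
      ∫⁻ K, h K * volume (boundaryShifts K r) ∂grainMeasure P₀ Φ := by
    intro r
    have hb := measurableSet_boundaryGrains (d := d) r
    rw [← lintegral_indicator hb, campbell hstat hΦ hfin.ne (hm.indicator hb)]
    refine lintegral_congr fun K => ?_
    have hbK : MeasurableSet (boundaryShifts K r) :=
      (Grain.measurable_translate.comp (measurable_id.prodMk measurable_const)) hb
    rw [← lintegral_indicator_const hbK]
    refine lintegral_congr fun x => ?_
    by_cases hx : x ∈ boundaryShifts K r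
    · rw [indicator_of_mem hx, indicator_of_mem (show K.translate x ∈ boundaryGrains d r from hx),
        hinv]
    · rw [indicator_of_notMem hx,
        indicator_of_notMem (show K.translate x ∉ boundaryGrains d r from hx)]
  have hdiv : ∀ m : ℕ, (∫⁻ K in boundaryGrains d (m + 1 : ℕ), h K ∂intensityMeasure P₀ Φ) /
      ((m + 1 : ℕ) : ℝ≥0∞) ^ d = ∫⁻ K, h K * (volume (boundaryShifts K (m + 1 : ℕ)) /
        ((m + 1 : ℕ) : ℝ≥0∞) ^ d) ∂grainMeasure P₀ Φ := by
    intro m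
    rw [hcampbell, div_eq_mul_inv]
    refine (lintegral_mul_const _ (hm.mul (measurable_volume_boundaryShifts _))).symm.trans ?_
    simp only [Pi.mul_apply, div_eq_mul_inv, mul_assoc]
  simp_rw [hdiv]
  have hdom := tendsto_lintegral_of_dominated_convergence (μ := grainMeasure P₀ Φ)
    (F := fun (m : ℕ) K => h K * (volume (boundaryShifts K (m + 1 : ℕ)) /
      ((m + 1 : ℕ) : ℝ≥0∞) ^ d)) (f := fun _ => 0)
    (fun K => h K + volume ((K : Set (Space d)) + cube d (-1) 1) * (h K : ℝ≥0∞))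
    (fun m => hm.mul ((measurable_volume_boundaryShifts _).div_const _)) ?_ ?_ ?_
  · simpa using hdom
  · refine fun m => Eventually.of_forall fun K => ?_
    have hpos : ((m + 1 : ℕ) : ℝ≥0∞) ^ d ≠ 0 := pow_ne_zero _ (by exact_mod_cast m.succ_ne_zero)
    have htop : ((m + 1 : ℕ) : ℝ≥0∞) ^ d ≠ ∞ := ENNReal.pow_ne_top (ENNReal.natCast_ne_top _)
    calc (h K : ℝ≥0∞) * (volume (boundaryShifts K (m + 1 : ℕ)) / ((m + 1 : ℕ) : ℝ≥0∞) ^ d)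
        ≤ h K * (1 + volume ((K : Set (Space d)) + cube d (-1) 1)) := by
          refine mul_le_mul_right ?_ _
          exact ENNReal.div_le_of_le_mul' (volume_boundaryShifts_le K m.succ_pos)
      _ = h K + volume ((K : Set (Space d)) + cube d (-1) 1) * (h K : ℝ≥0∞) := by
          rw [mul_add, mul_one, mul_comm (volume _)]
  · rw [lintegral_add_left hm, ← hIntensity_eq hΦ hfin.ne,
      ← intensity_mul_lintegral_typicalGrain hΦ hfin.ne]
    exact ENNReal.add_ne_top.2 ⟨hhfin.ne, ENNReal.mul_ne_top hfin.ne hsize.ne⟩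
  · refine Eventually.of_forall fun K => ?_
    have := ENNReal.Tendsto.const_mul (tendsto_volume_boundaryShifts K)
      (Or.inr (ENNReal.coe_ne_top (r := h K)))
    simpa using this

/-- The value inside a cube of any thinning `T'` is at most the value of the particles of a locally
maximal thinning `T` that meet the cube: both are compared with the best value available in the
cube, which depends only on `Φ`, so that the two thinnings need not be defined on the same
probability space. -/
theorem setLIntegral_inside_le_hitting (hΦ : Measurable Φ) (hmeas : Measurable h)
    {T : HardCoreThinning P₀ Φ} (hT : T ∈ locallyMaximal h P₀ Φ) (T' : HardCoreThinning P₀ Φ)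
    (r : ℝ) :
    ∫⁻ ω, ∫⁻ K in insideGrains d r, h K ∂(T'.Ψ ω).toMeasure ∂T'.P ≤
      ∫⁻ ω, ∫⁻ K in hittingGrains d r, h K ∂(T.Ψ ω).toMeasure ∂T.P := by
  have hb := measurable_bestValue hmeas r
  calc ∫⁻ ω, ∫⁻ K in insideGrains d r, h K ∂(T'.Ψ ω).toMeasure ∂T'.P
      ≤ ∫⁻ ω, bestValue h r (Φ (T'.S ω)) ∂T'.P := by
        refine lintegral_mono_ae ?_
        filter_upwards [T'.hardCore] with ω hω
        exact le_bestValue (T'.subset ω) hω r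
    _ = ∫⁻ ω, bestValue h r (Φ (T.S ω)) ∂T.P := by
        rw [T'.lintegral_base hΦ hb, T.lintegral_base hΦ hb]
    _ ≤ ∫⁻ ω, ∫⁻ K in hittingGrains d r, h K ∂(T.Ψ ω).toMeasure ∂T.P := by
        refine lintegral_mono_ae ?_
        filter_upwards [hT] with ω hω
        exact bestValue_le hω r

/-- In the cube `[0, r]^d`, the `h`-intensity of a thinning exceeds that of a locally maximal one by
at most the contribution of the boundary grains. -/
theorem hIntensity_mul_le (hΦ : Measurable Φ)
    (hfin : intensity P₀ Φ < ∞) (hmeas : Measurable h)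
    (hinv : ∀ (x : Space d) (K : Grain d), h (K.translate x) = h K)
    {T : HardCoreThinning P₀ Φ} (hT : T ∈ locallyMaximal h P₀ Φ) (T' : HardCoreThinning P₀ Φ)
    (r : ℝ) :
    hIntensity h T'.P T'.Ψ * volume (cube d 0 r) ≤
      hIntensity h T.P T.Ψ * volume (cube d 0 r) +
        ∫⁻ K in boundaryGrains d r, h K ∂intensityMeasure P₀ Φ := by
  have hm : Measurable fun K => (h K : ℝ≥0∞) := hmeas.coe_nnreal_ennreal
  have hc := measurableSet_center (d := d) (measurableSet_cube 0 r)
  have hin := measurableSet_insideGrains (d := d) r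
  have hhit := measurableSet_hittingGrains (d := d) r
  have hval : ∀ (T : HardCoreThinning P₀ Φ) {A : Set (Grain d)}, MeasurableSet A →
      ∫⁻ ω, ∫⁻ K in A, h K ∂(T.Ψ ω).toMeasure ∂T.P =
        ∫⁻ K in A, h K ∂intensityMeasure T.P T.Ψ := fun T A hA =>
    (setLIntegral_intensityMeasure T.measurable_Ψ hm hA).symm
  have hbase : ∀ (T : HardCoreThinning P₀ Φ) {A : Set (Grain d)}, MeasurableSet A →
      ∫⁻ K in A, h K ∂intensityMeasure T.P T.Ψ ≤ ∫⁻ K in A, h K ∂intensityMeasure P₀ Φ := by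
    intro T A hA
    rw [← hval T hA, setLIntegral_intensityMeasure hΦ hm hA]
    exact T.setLIntegral_le hΦ hm hA
  have hmain := setLIntegral_inside_le_hitting hΦ hmeas hT T' r
  rw [hval T' hin, hval T hhit] at hmain
  rw [← T'.setLIntegral_center hΦ hfin hmeas hinv (measurableSet_cube 0 r),
    ← T.setLIntegral_center hΦ hfin hmeas hinv (measurableSet_cube 0 r), hval T' hc, hval T hc,
    boundaryGrains, lintegral_union (hhit.diff hc)
      (disjoint_sdiff_right.mono_left sdiff_subset)]
  set C : Set (Grain d) := {K | K.center ∈ cube d 0 r}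
  calc ∫⁻ K in C, h K ∂intensityMeasure T'.P T'.Ψ
      ≤ ∫⁻ K in insideGrains d r ∪ C \ insideGrains d r, h K ∂intensityMeasure T'.P T'.Ψ :=
        lintegral_mono_set fun K hK => by
          by_cases hKi : K ∈ insideGrains d r
          · exact Or.inl hKi
          · exact Or.inr ⟨hK, hKi⟩
    _ ≤ ∫⁻ K in insideGrains d r, h K ∂intensityMeasure T'.P T'.Ψ +
          ∫⁻ K in C \ insideGrains d r, h K ∂intensityMeasure T'.P T'.Ψ := lintegral_union_le _ _ _
    _ ≤ ∫⁻ K in hittingGrains d r, h K ∂intensityMeasure T.P T.Ψ +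
          ∫⁻ K in C \ insideGrains d r, h K ∂intensityMeasure P₀ Φ :=
        add_le_add hmain (hbase T' (hc.diff hin))
    _ ≤ ∫⁻ K in C ∪ hittingGrains d r \ C, h K ∂intensityMeasure T.P T.Ψ +
          ∫⁻ K in C \ insideGrains d r, h K ∂intensityMeasure P₀ Φ := by
        gcongr
        rw [union_sdiff_self]
        exact subset_union_right
    _ ≤ ∫⁻ K in C, h K ∂intensityMeasure T.P T.Ψ +
          ∫⁻ K in hittingGrains d r \ C, h K ∂intensityMeasure T.P T.Ψ +
          ∫⁻ K in C \ insideGrains d r, h K ∂intensityMeasure P₀ Φ := by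
        gcongr
        exact lintegral_union_le _ _ _
    _ ≤ ∫⁻ K in C, h K ∂intensityMeasure T.P T.Ψ +
          (∫⁻ K in C \ insideGrains d r, h K ∂intensityMeasure P₀ Φ +
            ∫⁻ K in hittingGrains d r \ C, h K ∂intensityMeasure P₀ Φ) := by
        rw [add_assoc, add_comm (∫⁻ K in hittingGrains d r \ C, h K ∂intensityMeasure T.P T.Ψ)]
        exact add_le_add_right (add_le_add_right (hbase T (hhit.diff hc)) _) _

theorem locallyMaximal_subset_intensityMaximal (hΦ : Measurable Φ) (hstat : IsStationary P₀ Φ)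
    (hfin : intensity P₀ Φ < ∞) (hmeas : Measurable h)
    (hinv : ∀ (x : Space d) (K : Grain d), h (K.translate x) = h K)
    (hhfin : hIntensity h P₀ Φ < ∞)
    (hsize : ∫⁻ K, volume ((K : Set (Space d)) + cube d (-1) 1) * (h K : ℝ≥0∞)
      ∂(typicalGrain P₀ Φ) < ∞) :
    locallyMaximal h P₀ Φ ⊆ intensityMaximal h P₀ Φ := by
  intro T hT
  refine le_antisymm (le_iSup (fun T : HardCoreThinning P₀ Φ => hIntensity h T.P T.Ψ) T)
    (iSup_le fun T' => ?_)
  have hlim := (tendsto_boundary_value hΦ hstat hfin hmeas hinv hhfin hsize).const_add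
    (hIntensity h T.P T.Ψ)
  rw [add_zero] at hlim
  refine ge_of_tendsto' hlim fun m => ?_
  have hpos : ((m + 1 : ℕ) : ℝ≥0∞) ^ d ≠ 0 := pow_ne_zero _ (by exact_mod_cast m.succ_ne_zero)
  have htop : ((m + 1 : ℕ) : ℝ≥0∞) ^ d ≠ ∞ := ENNReal.pow_ne_top (ENNReal.natCast_ne_top _)
  have hle := hIntensity_mul_le hΦ hfin hmeas hinv hT T' ((m + 1 : ℕ) : ℝ)
  rw [volume_cube_natCast] at hle
  rw [← ENNReal.mul_div_cancel_right hpos htop (a := hIntensity h T.P T.Ψ), ← ENNReal.add_div,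
    ENNReal.le_div_iff_mul_le (Or.inl hpos) (Or.inl htop)]
  exact hle

end IntensityMaximal

end HardCore

theorem theorem3 {d : ℕ} (hd : 1 ≤ d)
    {Ω₀ : Type u} [MeasurableSpace Ω₀] (P₀ : Measure Ω₀) [IsProbabilityMeasure P₀]
    (Φ : Ω₀ → HardCore.Config d) (hΦ : Measurable Φ) (hstat : HardCore.IsStationary P₀ Φ)
    (hpos : HardCore.intensity P₀ Φ ≠ 0) (hfin : HardCore.intensity P₀ Φ < ∞)
    (h : HardCore.Grain d → ℝ≥0) (hmeas : Measurable h)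
    (hinv : ∀ (x : EuclideanSpace ℝ (Fin d)) (K : HardCore.Grain d), h (K.translate x) = h K)
    (hhfin : HardCore.hIntensity h P₀ Φ < ∞) :
    HardCore.intensityMaximal h P₀ Φ ⊆ HardCore.locallyMaximal h P₀ Φ ∧
      (∫⁻ K, volume ((K : Set (EuclideanSpace ℝ (Fin d))) + HardCore.cube d (-1) 1) * (h K : ℝ≥0∞)
          ∂(HardCore.typicalGrain P₀ Φ) < ∞ →
        HardCore.intensityMaximal h P₀ Φ = HardCore.locallyMaximal h P₀ Φ) := by
  have hsub := HardCore.intensityMaximal_subset_locallyMaximal hΦ hstat hfin hmeas hinv hhfin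
  exact ⟨hsub, fun hsize => hsub.antisymm
    (HardCore.locallyMaximal_subset_intensityMaximal hΦ hstat hfin hmeas hinv hhfin hsize)⟩
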